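/- Let $n\ge 1$ and let $M$ be a smooth manifold of dimension $2n+1$ with an almost contact B-metric structure $(\varphi,\xi,\eta,g)$: $\varphi$ is an endomorphism of $TM$, $\xi$ (the Reeb vector field) is a vector field, $\eta$ is a 1-form and $g$ is a pseudo-Riemannian metric of signature $(n+1,n)$, all smooth, with $$\varphi\xi=0,\quad \varphi^2=-\mathrm{id}+\eta\otimes\xi,\quad \eta\circ\varphi=0,\quad \eta(\xi)=1,\quad g(\varphi x,\varphi y)=-g(x,y)+\eta(x)\eta(y).$$ Let $\tilde g(x,y)=g(x,\varphi y)+\eta(x)\eta(y)$ be the associated metric, $\nabla$ the Levi-Civita connection of $g$, and $\rho$ its Ricci tensor, $\rho(y,z)=\operatorname{tr}(x\mapsto R(x,y)z)$ with $R(x,y)z=\nabla_x\nabla_yz-\nabla_y\nabla_xz-\nabla_{[x,y]}z$. Assume that the manifold is Sasaki-like, that is, $$(\nabla_x\varphi)y=-g(x,y)\xi-\eta(y)x+2\eta(x)\eta(y)\xi .$$ Let $k$ be a differentiable function on $M$ and $\lambda,\mu,\nu\in\mathbb R$, and suppose that $M$ admits a Ricci-like soliton with potential $v=k\xi$ and constants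 $(\lambda,\mu,\nu)$, that is, $$\tfrac12\mathcal L_{v}g+\rho+\lambda g+\mu\tilde g+\nu\,\eta\otimes\eta=0 .$$ Then $k=\mu$ on $M$ (so $k$ is constant), $\lambda+\nu=-k-2n$, and the manifold is $\eta$-Einstein with constants $(a,b,c)=(-\lambda,0,\lambda+2n)$, where Einstein-like with constants $(a,b,c)$ means $\rho=a\,g+b\,\tilde g+c\,\eta\otimes\eta$, and $\eta$-Einstein means Einstein-like with $b=0$; that is, $\rho=-\lambda g+(\lambda+2n)\,\eta\otimes\eta$. -/

import Mathlib

open Bundle Manifold VectorField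
open scoped ContDiff

noncomputable section

section PseudoRiemannian

variable {E : Type*} [NormedAddCommGroup E] [NormedSpace ℝ E]
  {H : Type*} [TopologicalSpace H] (I : ModelWithCorners ℝ E H)
  (M : Type*) [TopologicalSpace M] [ChartedSpace H M]

/-- A smooth pseudo-Riemannian metric (of arbitrary signature) on a smooth manifold. -/
structure PseudoRiemannianMetric [IsManifold I ∞ M] where
  /-- The scalar product on each tangent space. -/
  val (p : M) : TangentSpace I p →L[ℝ] TangentSpace I p →L[ℝ] ℝ
  symm (p : M) (x y : TangentSpace I p) : val p x y = val p y x
  nondegenerate (p : M) (x : TangentSpace I p) (hx : ∀ y, val p x y = 0) : x = 0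
  contMDiff : ContMDiff I (I.prod 𝓘(ℝ, E →L[ℝ] E →L[ℝ] ℝ)) ∞
    (fun p ↦ TotalSpace.mk' (E →L[ℝ] E →L[ℝ] ℝ)
      (E := fun p : M ↦ TangentSpace I p →L[ℝ] TangentSpace I p →L[ℝ] ℝ) p (val p))

end PseudoRiemannian

namespace PseudoRiemannianMetric

variable {E : Type*} [NormedAddCommGroup E] [NormedSpace ℝ E]
  {H : Type*} [TopologicalSpace H] {I : ModelWithCorners ℝ E H}
  {M : Type*} [TopologicalSpace M] [ChartedSpace H M] [IsManifold I ∞ M]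
  (g : PseudoRiemannianMetric I M)

/-- The function `g(X, Y)`. -/
def pairing (X Y : Π p : M, TangentSpace I p) (p : M) : ℝ := g.val p (X p) (Y p)

/-- The quadratic form `x ↦ g(x, x)` on a tangent space. -/
def quadraticForm (p : M) : QuadraticForm ℝ (TangentSpace I p) :=
  LinearMap.BilinMap.toQuadraticMap
    (LinearMap.mk₂ ℝ (fun x y ↦ g.val p x y) (by simp) (by simp) (by simp) (by simp))

/-- The right-hand side of the Koszul formula,
`X g(Y, Z) + Y g(X, Z) - Z g(X, Y) + g([X, Y], Z) - g([X, Z], Y) - g([Y, Z], X)`. -/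
def koszul (X Y Z : Π p : M, TangentSpace I p) (p : M) : ℝ :=
  mvfderiv I (g.pairing Y Z) p (X p) + mvfderiv I (g.pairing X Z) p (Y p)
    - mvfderiv I (g.pairing X Y) p (Z p)
    + g.val p (mlieBracket I X Y p) (Z p) - g.val p (mlieBracket I X Z p) (Y p)
    - g.val p (mlieBracket I Y Z p) (X p)

/-- The Lie derivative `(L_v g)(X, Y) = v g(X, Y) - g([v, X], Y) - g(X, [v, Y])`. -/
def lieDerivative (v X Y : Π p : M, TangentSpace I p) (p : M) : ℝ :=
  mvfderiv I (g.pairing X Y) p (v p)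
    - g.val p (mlieBracket I v X p) (Y p) - g.val p (X p) (mlieBracket I v Y p)

variable {g}

theorem mdifferentiableAt_pairing {X Y : Π p : M, TangentSpace I p} {p : M}
    (hX : MDiffAt (T% X) p) (hY : MDiffAt (T% Y) p) :
    MDifferentiableAt I 𝓘(ℝ) (g.pairing X Y) p := by
  have : MDifferentiableAt I (I.prod 𝓘(ℝ)) (fun m ↦ TotalSpace.mk' ℝ
      (E := Bundle.Trivial M ℝ) m (g.val m (X m) (Y m))) p := by
    apply MDifferentiableAt.clm_bundle_apply₂ (F₁ := E) (F₂ := E)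
    · exact g.contMDiff.mdifferentiableAt (by simp)
    · exact hX
    · exact hY
  simp only [mdifferentiableAt_totalSpace] at this
  exact this.2

theorem pairing_comm (X Y : Π p : M, TangentSpace I p) : g.pairing X Y = g.pairing Y X := by
  funext p; exact g.symm p _ _

theorem pairing_add_left (X X' Y : Π p : M, TangentSpace I p) :
    g.pairing (X + X') Y = g.pairing X Y + g.pairing X' Y := by
  funext p; simp [pairing]

theorem pairing_smul_left (f : M → ℝ) (X Y : Π p : M, TangentSpace I p) :
    g.pairing (f • X) Y = f * g.pairing X Y := by
  funext p; simp [pairing]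

theorem pairing_add_right (X Y Y' : Π p : M, TangentSpace I p) :
    g.pairing X (Y + Y') = g.pairing X Y + g.pairing X Y' := by
  funext p; simp [pairing]

theorem pairing_smul_right (f : M → ℝ) (X Y : Π p : M, TangentSpace I p) :
    g.pairing X (f • Y) = f * g.pairing X Y := by
  funext p; simp [pairing]

variable [CompleteSpace E]

theorem koszul_tensorial_left {Y Z : Π p : M, TangentSpace I p} {p : M}
    (hY : MDiffAt (T% Y) p) (hZ : MDiffAt (T% Z) p) :
    TensorialAt I E (fun X ↦ g.koszul X Y Z p) p where
  smul {f X} hf hX := by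
    have e1 := mdifferentiableAt_pairing (g := g) hX hZ
    have e2 := mdifferentiableAt_pairing (g := g) hX hY
    simp only [koszul, pairing_smul_left, mvfderiv_mul hf e1, mvfderiv_mul hf e2,
      mlieBracket_smul_left hf hX]
    simp [pairing]
    ring
  add {X X'} hX hX' := by
    have e1 := mdifferentiableAt_pairing (g := g) hX hZ
    have e2 := mdifferentiableAt_pairing (g := g) hX hY
    have e1' := mdifferentiableAt_pairing (g := g) hX' hZ
    have e2' := mdifferentiableAt_pairing (g := g) hX' hY
    simp only [koszul, pairing_add_left, mvfderiv_add e1 e1', mvfderiv_add e2 e2',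
      mlieBracket_add_left hX hX']
    simp
    ring

theorem koszul_tensorial_right {X Y : Π p : M, TangentSpace I p} {p : M}
    (hX : MDiffAt (T% X) p) (hY : MDiffAt (T% Y) p) :
    TensorialAt I E (fun Z ↦ g.koszul X Y Z p) p where
  smul {f Z} hf hZ := by
    have e1 := mdifferentiableAt_pairing (g := g) hX hZ
    have e2 := mdifferentiableAt_pairing (g := g) hY hZ
    simp only [koszul, pairing_smul_right, mvfderiv_mul hf e1, mvfderiv_mul hf e2,
      mlieBracket_smul_right hf hZ]
    simp [pairing, g.symm p (Z p)]
    ring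
  add {Z Z'} hZ hZ' := by
    have e1 := mdifferentiableAt_pairing (g := g) hX hZ
    have e2 := mdifferentiableAt_pairing (g := g) hY hZ
    have e1' := mdifferentiableAt_pairing (g := g) hX hZ'
    have e2' := mdifferentiableAt_pairing (g := g) hY hZ'
    simp only [koszul, pairing_add_right, mvfderiv_add e1 e1', mvfderiv_add e2 e2',
      mlieBracket_add_right hZ hZ']
    simp
    ring

theorem koszul_add_middle {X Y Y' Z : Π p : M, TangentSpace I p} {p : M}
    (hX : MDiffAt (T% X) p) (hY : MDiffAt (T% Y) p) (hY' : MDiffAt (T% Y') p)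
    (hZ : MDiffAt (T% Z) p) :
    g.koszul X (Y + Y') Z p = g.koszul X Y Z p + g.koszul X Y' Z p := by
  have e1 := mdifferentiableAt_pairing (g := g) hY hZ
  have e2 := mdifferentiableAt_pairing (g := g) hX hY
  have e1' := mdifferentiableAt_pairing (g := g) hY' hZ
  have e2' := mdifferentiableAt_pairing (g := g) hX hY'
  simp only [koszul, pairing_add_right, pairing_add_left, mvfderiv_add e1 e1',
    mvfderiv_add e2 e2', mlieBracket_add_right hY hY', mlieBracket_add_left hY hY']
  simp
  ring

theorem koszul_smul_middle {f : M → ℝ} {X Y Z : Π p : M, TangentSpace I p} {p : M}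
    (hf : MDiffAt f p) (hX : MDiffAt (T% X) p) (hY : MDiffAt (T% Y) p)
    (hZ : MDiffAt (T% Z) p) :
    g.koszul X (f • Y) Z p =
      f p * g.koszul X Y Z p + 2 * (mvfderiv I f p (X p) * g.val p (Y p) (Z p)) := by
  have e1 := mdifferentiableAt_pairing (g := g) hY hZ
  have e2 := mdifferentiableAt_pairing (g := g) hX hY
  simp only [koszul, pairing_smul_right, pairing_smul_left, mvfderiv_mul hf e1,
    mvfderiv_mul hf e2, mlieBracket_smul_right hf hY, mlieBracket_smul_left hf hY]
  simp [pairing, g.symm p (X p) (Y p)]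
  ring

variable [FiniteDimensional ℝ E]

/-- The isomorphism `x ↦ g(x, ·)` from the tangent space to its dual. -/
def flat (g : PseudoRiemannianMetric I M) (p : M) :
    TangentSpace I p ≃ₗ[ℝ] (TangentSpace I p →L[ℝ] ℝ) :=
  haveI : FiniteDimensional ℝ (TangentSpace I p) := inferInstanceAs (FiniteDimensional ℝ E)
  haveI : T2Space (TangentSpace I p) := inferInstanceAs (T2Space E)
  LinearMap.linearEquivOfInjective (g.val p).toLinearMap
    ((injective_iff_map_eq_zero _).2 fun x hx ↦
      g.nondegenerate p x fun y ↦ by simpa using congrArg (fun L ↦ L y) hx)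
    ((Subspace.dual_finrank_eq (K := ℝ) (V := TangentSpace I p)).symm.trans
      (LinearMap.toContinuousLinearMap (𝕜 := ℝ) (E := TangentSpace I p) (F' := ℝ)).finrank_eq)

open scoped Classical in
/-- The value at `p` of the Levi-Civita covariant derivative of the vector field `Y`, as a linear
map `x ↦ ∇ₓ Y` on `T_p M`: it is given by the Koszul formula `2 g(∇_X Y, Z) = koszul X Y Z`
(see `val_leviCivitaAux`), and set to `0` when `Y` is not differentiable at `p`. -/
def leviCivitaAux (g : PseudoRiemannianMetric I M) (Y : Π p : M, TangentSpace I p) (p : M) :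
    TangentSpace I p →L[ℝ] TangentSpace I p :=
  haveI : FiniteDimensional ℝ (TangentSpace I p) := inferInstanceAs (FiniteDimensional ℝ E)
  haveI : T2Space (TangentSpace I p) := inferInstanceAs (T2Space E)
  if hY : MDiffAt (T% Y) p then
    LinearMap.toContinuousLinearMap <| (1 / 2 : ℝ) • ((g.flat p).symm.toLinearMap ∘ₗ
      (TensorialAt.mkHom₂ (I := I) (F := E) (F' := E) (fun X Z ↦ g.koszul X Y Z p) p
        (fun _ hZ ↦ koszul_tensorial_left hY hZ)
        (fun _ hX ↦ koszul_tensorial_right hX hY)).toLinearMap)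
  else 0

/-- The Koszul formula. -/
theorem val_leviCivitaAux {X Y Z : Π p : M, TangentSpace I p} {p : M}
    (hX : MDiffAt (T% X) p) (hY : MDiffAt (T% Y) p) (hZ : MDiffAt (T% Z) p) :
    2 * g.val p (g.leviCivitaAux Y p (X p)) (Z p) = g.koszul X Y Z p := by
  have key : ∀ L, g.val p ((g.flat p).symm L) = L := fun L ↦ (g.flat p).apply_symm_apply L
  simp only [leviCivitaAux, dif_pos hY]
  simp [key]
  exact TensorialAt.mkHom₂_apply (I := I) (F := E) (F' := E)
    (Φ := fun X Z ↦ g.koszul X Y Z p) (fun _ hZ ↦ koszul_tensorial_left hY hZ)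
    (fun _ hX ↦ koszul_tensorial_right hX hY) hX hZ

theorem leviCivitaAux_eq {X Y : Π p : M, TangentSpace I p} {p : M} {w : TangentSpace I p}
    (hX : MDiffAt (T% X) p) (hY : MDiffAt (T% Y) p)
    (h : ∀ Z : Π p : M, TangentSpace I p, MDiffAt (T% Z) p →
      2 * g.val p w (Z p) = g.koszul X Y Z p) :
    g.leviCivitaAux Y p (X p) = w := by
  rw [← sub_eq_zero]
  refine g.nondegenerate p _ fun z ↦ ?_
  have hz := FiberBundle.mdifferentiableAt_extend I E z
  have e1 := h _ hz
  have e2 := val_leviCivitaAux (g := g) hX hY hz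
  simp at e1 e2 ⊢
  linarith

/-- The Levi-Civita connection of a pseudo-Riemannian metric: `g.leviCivita Y p x` is the
covariant derivative `∇ₓ Y` at the point `p` in the direction `x ∈ T_p M`. -/
def leviCivita (g : PseudoRiemannianMetric I M) :
    CovariantDerivative I E (TangentSpace I : M → Type _) where
  toFun := g.leviCivitaAux
  isCovariantDerivativeOnUniv :=
    { add := by
        intro Y Y' p hY hY' _
        ext x
        have hx := FiberBundle.mdifferentiableAt_extend I E x
        have := leviCivitaAux_eq (g := g) (w := g.leviCivitaAux Y p x + g.leviCivitaAux Y' p x) hx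
          (mdifferentiableAt_add_section hY hY') (fun Z hZ ↦ by
            have e1 := val_leviCivitaAux (g := g) hx hY hZ
            have e2 := val_leviCivitaAux (g := g) hx hY' hZ
            simp only [FiberBundle.extend_apply_self] at e1 e2
            rw [koszul_add_middle hx hY hY' hZ, ← e1, ← e2]
            simp
            ring)
        simpa using this
      leibniz := by
        intro Y f p hY hf _
        ext x
        have hx := FiberBundle.mdifferentiableAt_extend I E x
        have := leviCivitaAux_eq (g := g)
          (w := f p • g.leviCivitaAux Y p x + mvfderiv I f p x • Y p) hx
          (hf.smul_section hY) (fun Z hZ ↦ by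
            have e1 := val_leviCivitaAux (g := g) hx hY hZ
            simp only [FiberBundle.extend_apply_self] at e1
            rw [koszul_smul_middle hf hx hY hZ, ← e1]
            simp
            ring)
        simpa using this }

/-- The Levi-Civita connection is compatible with the metric. -/
theorem leviCivita_metric {X Y Z : Π p : M, TangentSpace I p} {p : M}
    (hX : MDiffAt (T% X) p) (hY : MDiffAt (T% Y) p) (hZ : MDiffAt (T% Z) p) :
    mvfderiv I (g.pairing Y Z) p (X p) =
      g.val p (g.leviCivita Y p (X p)) (Z p) + g.val p (Y p) (g.leviCivita Z p (X p)) := by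
  have e1 := val_leviCivitaAux (g := g) hX hY hZ
  have e2 := val_leviCivitaAux (g := g) hX hZ hY
  simp only [koszul, pairing_comm Z Y, mlieBracket_swap (V := Z) (W := Y)] at e1 e2
  simp at e1 e2
  rw [g.symm p (Y p)]
  simp only [leviCivita]
  linarith

/-- The Levi-Civita connection is torsion-free. -/
theorem leviCivita_torsion {X Y : Π p : M, TangentSpace I p} {p : M}
    (hX : MDiffAt (T% X) p) (hY : MDiffAt (T% Y) p) :
    g.leviCivita Y p (X p) - g.leviCivita X p (Y p) = mlieBracket I X Y p := by
  rw [sub_eq_iff_eq_add]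
  refine leviCivitaAux_eq hX hY fun Z hZ ↦ ?_
  have e1 := val_leviCivitaAux (g := g) hY hX hZ
  simp only [koszul, pairing_comm Y X, mlieBracket_swap (V := Y) (W := X)] at e1 ⊢
  simp only [leviCivita]
  simp at e1 ⊢
  linarith

/-- The curvature `R(X, Y)Z = ∇_X ∇_Y Z - ∇_Y ∇_X Z - ∇_{[X, Y]} Z` on vector fields. -/
def curvature (g : PseudoRiemannianMetric I M) (X Y Z : Π p : M, TangentSpace I p) (p : M) :
    TangentSpace I p :=
  g.leviCivita (fun q ↦ g.leviCivita Z q (Y q)) p (X p)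
    - g.leviCivita (fun q ↦ g.leviCivita Z q (X q)) p (Y p)
    - g.leviCivita Z p (mlieBracket I X Y p)

/-- The curvature tensor `R(x, y)z` on tangent vectors at `p`; as `R` is tensorial, its value does
not depend on the vector fields, smooth near `p`, that extend the three vectors. -/
def curvatureTensor (g : PseudoRiemannianMetric I M) (p : M) (x y z : TangentSpace I p) :
    TangentSpace I p :=
  g.curvature (FiberBundle.extend E x) (FiberBundle.extend E y) (FiberBundle.extend E z) p

/-- The Ricci tensor `ρ(y, z) = trace (x ↦ R(x, y)z)`; the trace is computed in a basis of the
tangent space. -/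
def ricci (g : PseudoRiemannianMetric I M) (p : M) (y z : TangentSpace I p) : ℝ :=
  haveI : FiniteDimensional ℝ (TangentSpace I p) := inferInstanceAs (FiniteDimensional ℝ E)
  let b := Module.finBasis ℝ (TangentSpace I p)
  ∑ i, b.repr (g.curvatureTensor p (b i) y z) i

end PseudoRiemannianMetric

section AlmostContact

variable (n : ℕ) (M : Type*) [TopologicalSpace M]
  [ChartedSpace (EuclideanSpace ℝ (Fin (2 * n + 1))) M]
  [IsManifold (𝓡 (2 * n + 1)) ∞ M]

/-- An almost contact B-metric structure `(φ, ξ, η, g)` on a smooth manifold of dimension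
`2n + 1`. -/
structure AlmostContactBMetric where
  /-- The endomorphism of the tangent bundle. -/
  φ (p : M) : TangentSpace (𝓡 (2 * n + 1)) p →L[ℝ] TangentSpace (𝓡 (2 * n + 1)) p
  /-- The Reeb vector field. -/
  ξ (p : M) : TangentSpace (𝓡 (2 * n + 1)) p
  /-- The contact 1-form. -/
  η (p : M) : TangentSpace (𝓡 (2 * n + 1)) p →L[ℝ] ℝ
  /-- The B-metric. -/
  g : PseudoRiemannianMetric (𝓡 (2 * n + 1)) M
  contMDiff_φ : ContMDiff (𝓡 (2 * n + 1))
    ((𝓡 (2 * n + 1)).prod 𝓘(ℝ, EuclideanSpace ℝ (Fin (2 * n + 1)) →L[ℝ]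
      EuclideanSpace ℝ (Fin (2 * n + 1)))) ∞
    (fun p ↦ TotalSpace.mk' (EuclideanSpace ℝ (Fin (2 * n + 1)) →L[ℝ]
      EuclideanSpace ℝ (Fin (2 * n + 1)))
      (E := fun p : M ↦ TangentSpace (𝓡 (2 * n + 1)) p →L[ℝ] TangentSpace (𝓡 (2 * n + 1)) p)
      p (φ p))
  contMDiff_ξ : ContMDiff (𝓡 (2 * n + 1)) (𝓡 (2 * n + 1)).tangent ∞
    (fun p ↦ (⟨p, ξ p⟩ : TangentBundle (𝓡 (2 * n + 1)) M))
  contMDiff_η : ContMDiff (𝓡 (2 * n + 1))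
    ((𝓡 (2 * n + 1)).prod 𝓘(ℝ, EuclideanSpace ℝ (Fin (2 * n + 1)) →L[ℝ] ℝ)) ∞
    (fun p ↦ TotalSpace.mk' (EuclideanSpace ℝ (Fin (2 * n + 1)) →L[ℝ] ℝ)
      (E := fun p : M ↦ TangentSpace (𝓡 (2 * n + 1)) p →L[ℝ] ℝ) p (η p))
  φ_ξ (p : M) : φ p (ξ p) = 0
  φ_φ (p : M) (x : TangentSpace (𝓡 (2 * n + 1)) p) : φ p (φ p x) = -x + η p x • ξ p
  η_φ (p : M) (x : TangentSpace (𝓡 (2 * n + 1)) p) : η p (φ p x) = 0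
  η_ξ (p : M) : η p (ξ p) = 1
  g_φ_φ (p : M) (x y : TangentSpace (𝓡 (2 * n + 1)) p) :
    g.val p (φ p x) (φ p y) = -g.val p x y + η p x * η p y
  signature (p : M) : sigPos (g.quadraticForm p) = n + 1 ∧ sigNeg (g.quadraticForm p) = n

end AlmostContact

namespace AlmostContactBMetric

variable {n : ℕ} {M : Type*} [TopologicalSpace M]
  [ChartedSpace (EuclideanSpace ℝ (Fin (2 * n + 1))) M]
  [IsManifold (𝓡 (2 * n + 1)) ∞ M]

/-- The associated metric `g̃(x, y) = g(x, φ y) + η(x) η(y)`. -/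
def assocMetric (S : AlmostContactBMetric n M) (p : M)
    (x y : TangentSpace (𝓡 (2 * n + 1)) p) : ℝ :=
  S.g.val p x (S.φ p y) + S.η p x * S.η p y

/-- The Sasaki-like condition `(∇ₓ φ)Y = -g(x, Y) ξ - η(Y) x + 2 η(x) η(Y) ξ`, where
`(∇ₓ φ)Y = ∇ₓ (φ Y) - φ (∇ₓ Y)` and `∇` is the Levi-Civita connection of `g`. -/
def IsSasakiLike (S : AlmostContactBMetric n M) : Prop :=
  ∀ (p : M) (x : TangentSpace (𝓡 (2 * n + 1)) p) (Y : Π q : M, TangentSpace (𝓡 (2 * n + 1)) q),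
    MDifferentiableAt (𝓡 (2 * n + 1)) (𝓡 (2 * n + 1)).tangent
        (fun q ↦ (⟨q, Y q⟩ : TangentBundle (𝓡 (2 * n + 1)) M)) p →
      S.g.leviCivita (fun q ↦ S.φ q (Y q)) p x - S.φ p (S.g.leviCivita Y p x) =
        -S.g.val p x (Y p) • S.ξ p - S.η p (Y p) • x + (2 * S.η p x * S.η p (Y p)) • S.ξ p

/-- A Ricci-like soliton with potential vector field `v` and constants `(lam, μ, ν)`:
`½ L_v g + ρ + lam g + μ g̃ + ν η ⊗ η = 0`, where `ρ` is the Ricci tensor of `g`. -/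
def IsRicciLikeSoliton (S : AlmostContactBMetric n M)
    (v : Π p : M, TangentSpace (𝓡 (2 * n + 1)) p) (lam μ ν : ℝ) : Prop :=
  ∀ (p : M) (X Y : Π q : M, TangentSpace (𝓡 (2 * n + 1)) q),
    MDifferentiableAt (𝓡 (2 * n + 1)) (𝓡 (2 * n + 1)).tangent
        (fun q ↦ (⟨q, X q⟩ : TangentBundle (𝓡 (2 * n + 1)) M)) p →
      MDifferentiableAt (𝓡 (2 * n + 1)) (𝓡 (2 * n + 1)).tangent
        (fun q ↦ (⟨q, Y q⟩ : TangentBundle (𝓡 (2 * n + 1)) M)) p →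
      (1 / 2) * S.g.lieDerivative v X Y p + S.g.ricci p (X p) (Y p) + lam * S.g.val p (X p) (Y p)
        + μ * S.assocMetric p (X p) (Y p) + ν * (S.η p (X p) * S.η p (Y p)) = 0

/-- Einstein-like with constants `(a, b, c)`: `ρ = a g + b g̃ + c η ⊗ η`. -/
def IsEinsteinLike (S : AlmostContactBMetric n M) (a b c : ℝ) : Prop :=
  ∀ (p : M) (x y : TangentSpace (𝓡 (2 * n + 1)) p),
    S.g.ricci p x y = a * S.g.val p x y + b * S.assocMetric p x y + c * (S.η p x * S.η p y)

/-- `η`-Einstein with constants `(a, b, c)`: Einstein-like with `b = 0`. -/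
def IsEtaEinstein (S : AlmostContactBMetric n M) (a b c : ℝ) : Prop :=
  S.IsEinsteinLike a b c ∧ b = 0

end AlmostContactBMetric

end

/-!
The statement rests on two facts about a Sasaki-like manifold: `ρ(·, ξ) = 2n η`, and the Ricci
tensor is invariant under the flow of `ξ`.

Applying the Sasaki-like condition to `φ ξ = 0` gives `∇ₓ ξ = -φ x`
(`AlmostContactBMetric.IsSasakiLike.cov_ξ`), hence `R(x, y)ξ = η(y) x - η(x) y`, whose trace is
`ρ(·, ξ) = 2n η`, and also `L_ξ g = -2 g(·, φ ·)`, `L_ξ φ = 0`, `L_ξ η = 0`. The pair symmetry of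
the curvature gives `R(ξ, x)y`, and with it the Lie derivative of the connection,
`(L_ξ ∇)(x, y) = 2 (g(x, y) - η(x) η(y)) ξ` (`IsSasakiLike.mlieBracket_ξ_cov`). Differentiating once
more yields `L_ξ R`, and the trace of the result is a multiple of `tr φ`, which vanishes since
`φ³ = -φ`. So `L_ξ ρ = 0` (`IsSasakiLike.mvfderiv_ricci_ξ`).

With `v = k ξ` the soliton equation reads
`ρ = -λ g + (k - μ) g(·, φ ·) - (μ + ν) η ⊗ η - ½ (dk ⊗ η + η ⊗ dk)`. Comparing with
`ρ(·, ξ) = 2n η` gives `dk = -(λ + μ + ν + 2n) η` and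
`ρ = -λ g + (k - μ) g(·, φ ·) + (λ + 2n) η ⊗ η`. The Lie derivative of this along `ξ` is
`(2λ + dk(ξ)) g(·, φ ·) - 2 (k - μ) g(·, φ² ·) = 0`; as `φ` is a complex structure on the nonzero
distribution `ker η`, both coefficients vanish. Hence `k = μ`, so `dk = 0`, and the remaining
assertions follow.

All tensor calculus is done with vector fields smooth near a point. What it needs of a
pseudo-Riemannian metric is that the Levi-Civita connection preserves smoothness
(`FieldSmoothNear.cov`), that the curvature is tensorial (`curvature_congr`), its symmetries, and
that traces commute with Lie derivatives (`mvfderiv_ricci`).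
-/

noncomputable section

open Filter Topology

/-! ### Functions and vector fields smooth near a point -/

section SmoothNear

variable {E : Type*} [NormedAddCommGroup E] [NormedSpace ℝ E]
  {H : Type*} [TopologicalSpace H] {I : ModelWithCorners ℝ E H}
  {M : Type*} [TopologicalSpace M] [ChartedSpace H M]

/-- The function `f` is `C^∞` on a neighbourhood of `p`. This is stronger than being `C^∞` at `p`,
which only asks for a neighbourhood on which `f` is `C^n` for each finite `n` separately. -/
def SmoothNear (I : ModelWithCorners ℝ E H) (f : M → ℝ) (p : M) : Prop :=
  ∀ᶠ q in 𝓝 p, ContMDiffAt I 𝓘(ℝ) ∞ f q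

/-- The vector field `X` is `C^∞` on a neighbourhood of `p`. -/
def FieldSmoothNear [IsManifold I ∞ M] (X : Π p : M, TangentSpace I p) (p : M) : Prop :=
  ∀ᶠ q in 𝓝 p, CMDiffAt ∞ (T% X) q

namespace SmoothNear

variable {f h : M → ℝ} {p : M}

theorem contMDiffAt (hf : SmoothNear I f p) : ContMDiffAt I 𝓘(ℝ) ∞ f p := hf.self_of_nhds

theorem mdifferentiableAt (hf : SmoothNear I f p) : MDifferentiableAt I 𝓘(ℝ) f p :=
  hf.contMDiffAt.mdifferentiableAt (by simp)

theorem eventually (hf : SmoothNear I f p) : ∀ᶠ q in 𝓝 p, SmoothNear I f q :=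
  eventually_eventually_nhds.2 hf

theorem congr (hf : SmoothNear I f p) (hfh : ∀ᶠ q in 𝓝 p, h q = f q) : SmoothNear I h p := by
  filter_upwards [hf, eventually_eventually_nhds.2 hfh] with q hq hq'
  exact hq.congr_of_eventuallyEq hq'

theorem add (hf : SmoothNear I f p) (hh : SmoothNear I h p) : SmoothNear I (f + h) p := by
  filter_upwards [hf, hh] with q h1 h2 using h1.add h2

theorem sub (hf : SmoothNear I f p) (hh : SmoothNear I h p) : SmoothNear I (f - h) p := by
  filter_upwards [hf, hh] with q h1 h2 using h1.sub h2

theorem mul (hf : SmoothNear I f p) (hh : SmoothNear I h p) : SmoothNear I (f * h) p := by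
  filter_upwards [hf, hh] with q h1 h2 using h1.mul h2

theorem const (c : ℝ) : SmoothNear I (fun _ : M ↦ c) p :=
  Eventually.of_forall fun _ ↦ contMDiffAt_const

theorem sum {ι : Type*} {s : Finset ι} {f : ι → M → ℝ} (hf : ∀ i ∈ s, SmoothNear I (f i) p) :
    SmoothNear I (fun q ↦ ∑ i ∈ s, f i q) p := by
  filter_upwards [(eventually_all_finset s).2 hf] with q hq using ContMDiffAt.sum hq

theorem div (hf : SmoothNear I f p) (hh : SmoothNear I h p) (h0 : h p ≠ 0) :
    SmoothNear I (f / h) p := by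
  filter_upwards [hf, hh, hh.contMDiffAt.continuousAt.eventually_ne h0] with q h1 h2 h3
    using h1.div₀ h2 h3

theorem det {ι : Type*} [Fintype ι] [DecidableEq ι] {A : M → Matrix ι ι ℝ}
    (hA : ∀ i j, SmoothNear I (fun q ↦ A q i j) p) : SmoothNear I (fun q ↦ (A q).det) p := by
  have : ∀ᶠ q in 𝓝 p, ∀ i j, ContMDiffAt I 𝓘(ℝ) ∞ (fun q ↦ A q i j) q :=
    eventually_all.2 fun i ↦ eventually_all.2 fun j ↦ hA i j
  filter_upwards [this] with q hq
  simp only [Matrix.det_apply']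
  exact ContMDiffAt.sum fun σ _ ↦ contMDiffAt_const.mul (ContMDiffAt.prod fun i _ ↦ hq _ _)

end SmoothNear

namespace FieldSmoothNear

variable [IsManifold I ∞ M] {X Y : Π p : M, TangentSpace I p} {f : M → ℝ} {p : M}

theorem contMDiffAt (hX : FieldSmoothNear X p) : CMDiffAt ∞ (T% X) p := hX.self_of_nhds

theorem mdifferentiableAt (hX : FieldSmoothNear X p) : MDiffAt (T% X) p :=
  hX.contMDiffAt.mdifferentiableAt (by simp)

theorem eventually (hX : FieldSmoothNear X p) : ∀ᶠ q in 𝓝 p, FieldSmoothNear X q :=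
  eventually_eventually_nhds.2 hX

theorem congr (hX : FieldSmoothNear X p) (h : ∀ᶠ q in 𝓝 p, Y q = X q) : FieldSmoothNear Y p := by
  filter_upwards [hX, eventually_eventually_nhds.2 h] with q hq hq'
  refine hq.congr_of_eventuallyEq ?_
  filter_upwards [hq'] with r hr
  rw [hr]

theorem add (hX : FieldSmoothNear X p) (hY : FieldSmoothNear Y p) : FieldSmoothNear (X + Y) p := by
  filter_upwards [hX, hY] with q h1 h2 using h1.add_section h2

theorem sub (hX : FieldSmoothNear X p) (hY : FieldSmoothNear Y p) : FieldSmoothNear (X - Y) p := by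
  filter_upwards [hX, hY] with q h1 h2 using h1.sub_section h2

theorem smul (hf : SmoothNear I f p) (hX : FieldSmoothNear X p) : FieldSmoothNear (f • X) p := by
  filter_upwards [hf, hX] with q h1 h2 using h1.smul_section h2

theorem sum {ι : Type*} {s : Finset ι} {X : ι → Π p : M, TangentSpace I p}
    (hX : ∀ i ∈ s, FieldSmoothNear (X i) p) :
    FieldSmoothNear (fun q ↦ ∑ i ∈ s, X i q) p := by
  filter_upwards [(eventually_all_finset s).2 hX] with q hq using ContMDiffAt.sum_section hq

theorem extend [FiniteDimensional ℝ E] (x : TangentSpace I p) :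
    FieldSmoothNear (FiberBundle.extend E x) p := by
  obtain ⟨s, hs, h⟩ := FiberBundle.exists_contMDiffOn_extend (k := ∞) I E x
  filter_upwards [eventually_mem_nhds_iff.2 hs] with q hq using h.contMDiffAt hq

theorem mlieBracket [CompleteSpace E] (hX : FieldSmoothNear X p) (hY : FieldSmoothNear Y p) :
    FieldSmoothNear (mlieBracket I X Y) p := by
  filter_upwards [hX, hY] with q h1 h2
  have : IsManifold I (((⊤ : ℕ∞) : ℕ∞ω) + 1) M := by simpa using ‹IsManifold I ∞ M›
  have : IsManifold I (minSmoothness ℝ 2) M := by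
    rw [minSmoothness_of_isRCLikeNormedField]; infer_instance
  exact ContMDiffAt.mlieBracket_vectorField (m := ⊤) (n := ⊤) h1 h2 (by simp)

theorem mvfderiv (hf : SmoothNear I f p) (hX : FieldSmoothNear X p) :
    SmoothNear I (fun q ↦ mvfderiv I f q (X q)) p := by
  filter_upwards [hf, hX] with q h1 h2
  have := h1.mfderiv_const (m := ∞) (by simp)
  have := ContMDiffAt.clm_apply_of_inCoordinates (IB₁ := I) (IM := I) (IB₂ := 𝓘(ℝ))
    (b₁ := id) (b₂ := f) this h2 h1
  exact ((contMDiff_snd_tangentBundle_modelSpace ℝ 𝓘(ℝ)).contMDiffAt (x := _)).comp q this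

end FieldSmoothNear

theorem mvfderiv_congr {f h : M → ℝ} {p : M} (hfh : f =ᶠ[𝓝 p] h) :
    mvfderiv I f p = mvfderiv I h p := by
  have e : f p = h p := hfh.self_of_nhds
  simp only [mvfderiv, hfh.mfderiv_eq]
  rfl

theorem mvfderiv_finset_sum {ι : Type*} (s : Finset ι) {f : ι → M → ℝ} {p : M}
    (hf : ∀ i, SmoothNear I (f i) p) :
    mvfderiv I (fun q ↦ ∑ i ∈ s, f i q) p = ∑ i ∈ s, mvfderiv I (f i) p := by
  classical
  induction s using Finset.induction_on with
  | empty => simp [mvfderiv_const]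
  | insert a s ha ih =>
    simp only [Finset.sum_insert ha, ← ih]
    exact mvfderiv_fun_add (hf a).mdifferentiableAt
      (SmoothNear.sum fun i _ ↦ hf i).mdifferentiableAt

end SmoothNear

/-! ### Smooth frames and tensorial operations -/

section Frame

/-- The trace computed in a frame `e` with dual coframe `c`. -/
theorem LinearMap.trace_eq_sum_coframe {ι V : Type*} [Fintype ι] [AddCommGroup V]
    [Module ℝ V] [Module.Finite ℝ V] {e : ι → V} {c : ι → V →ₗ[ℝ] ℝ}
    (h : ∀ x, x = ∑ i, c i x • e i) (L : V →ₗ[ℝ] V) :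
    LinearMap.trace ℝ V L = ∑ i, c i (L (e i)) := by
  have : L = ∑ i, (c i).smulRight (L (e i)) := by
    ext x
    conv_lhs => rw [h x]
    simp
  conv_lhs => rw [this]
  simp [LinearMap.trace_smulRight]

variable {E : Type*} [NormedAddCommGroup E] [NormedSpace ℝ E] [FiniteDimensional ℝ E]
  {H : Type*} [TopologicalSpace H] (I : ModelWithCorners ℝ E H)
  {M : Type*} [TopologicalSpace M] [ChartedSpace H M] [IsManifold I ∞ M]

/-- Near every point the tangent bundle has a smooth frame `e` with a smooth dual coframe `c`. -/
theorem exists_smooth_frame (p : M) :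
    ∃ (e : Fin (Module.finrank ℝ E) → Π q : M, TangentSpace I q)
      (c : Fin (Module.finrank ℝ E) → Π q : M, TangentSpace I q →ₗ[ℝ] ℝ),
      (∀ i, FieldSmoothNear (e i) p) ∧
      (∀ i (X : Π q : M, TangentSpace I q), FieldSmoothNear X p →
        SmoothNear I (fun q ↦ c i q (X q)) p) ∧
      ∀ᶠ q in 𝓝 p, (∀ x : TangentSpace I q, x = ∑ i, c i q x • e i q) ∧
        ∀ i j, c i q (e j q) = if i = j then 1 else 0 := by
  set t := trivializationAt E (TangentSpace I : M → Type _) p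
  have hp : p ∈ t.baseSet := FiberBundle.mem_baseSet_trivializationAt' p
  have hs : ∀ᶠ q in 𝓝 p, q ∈ t.baseSet := t.open_baseSet.mem_nhds hp
  let b := Module.finBasis ℝ E
  refine ⟨fun i ↦ t.localFrame b i, fun i ↦ t.localFrameCoeff I b i, fun i ↦ ?_, fun i X hX ↦ ?_,
    ?_⟩
  · filter_upwards [hs] with q hq using contMDiffAt_localFrame_of_mem ∞ t b i hq
  · filter_upwards [hs, hX] with q hq hXq using contMDiffAt_localFrameCoeff b hq hXq i
  · filter_upwards [hs] with q hq
    refine ⟨fun x ↦ ?_, fun i j ↦ ?_⟩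
    · have := t.eq_sum_localFrameCoeff_smul (I := I) (b := b) (s := FiberBundle.extend E x) hq
      simpa using this
    · rw [t.localFrameCoeff_apply_of_mem_baseSet b hq]
      simp [t.localFrame_apply_of_mem_baseSet b hq, Finsupp.single_apply, eq_comm]

end Frame

section Tensorial

variable {E : Type*} [NormedAddCommGroup E] [NormedSpace ℝ E]
  {H : Type*} [TopologicalSpace H] {I : ModelWithCorners ℝ E H}
  {M : Type*} [TopologicalSpace M] [ChartedSpace H M] [IsManifold I ∞ M]
  {A : Type*} [AddCommGroup A] [Module ℝ A]

/-- An operation `Φ` on vector fields is linear over the germs at `p` of smooth functions, as long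
as it is applied to vector fields smooth near `p`. In contrast to `TensorialAt`, this allows `Φ` to
involve derivatives of any order. -/
structure SmoothTensorialAt (Φ : (Π p : M, TangentSpace I p) → A) (p : M) : Prop where
  smul {f : M → ℝ} {X : Π p : M, TangentSpace I p} :
    SmoothNear I f p → FieldSmoothNear X p → Φ (f • X) = f p • Φ X
  add {X Y : Π p : M, TangentSpace I p} :
    FieldSmoothNear X p → FieldSmoothNear Y p → Φ (X + Y) = Φ X + Φ Y

namespace SmoothTensorialAt

variable {Φ : (Π p : M, TangentSpace I p) → A} {p : M}

theorem congr (hΦ : SmoothTensorialAt Φ p) {X Y : Π p : M, TangentSpace I p}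
    (hX : FieldSmoothNear X p) (hY : FieldSmoothNear Y p) (h : ∀ᶠ q in 𝓝 p, X q = Y q) :
    Φ X = Φ Y := by
  classical
  -- multiply both fields by the indicator function of the set where they agree
  let ψ (q : M) : ℝ := if X q = Y q then 1 else 0
  have hψ : SmoothNear I ψ p := (SmoothNear.const 1).congr (h.mono fun q hq ↦ by simp [ψ, hq])
  have hψp : ψ p = 1 := by simp [ψ, h.self_of_nhds]
  have key : ψ • X = ψ • Y := by
    funext q
    by_cases hq : X q = Y q <;> simp [ψ, hq]
  simpa [hψp, hΦ.smul hψ hX, hΦ.smul hψ hY] using congrArg Φ key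

theorem sum (hΦ : SmoothTensorialAt Φ p) {ι : Type*} (s : Finset ι)
    {X : ι → Π p : M, TangentSpace I p} (hX : ∀ i, FieldSmoothNear (X i) p) :
    Φ (fun q ↦ ∑ i ∈ s, X i q) = ∑ i ∈ s, Φ (X i) := by
  classical
  induction s using Finset.induction_on with
  | empty =>
    have h0 : FieldSmoothNear (fun q : M ↦ (0 : TangentSpace I q)) p := by
      simpa using! FieldSmoothNear.sum (I := I) (p := p) (s := ∅)
        (X := fun (_ : Empty) q ↦ (0 : TangentSpace I q)) (by simp)
    have := hΦ.smul (f := fun _ ↦ 0) (SmoothNear.const 0) h0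
    simpa [Pi.smul_def'] using! this
  | insert a s ha ih =>
    simp only [Finset.sum_insert ha, ← ih]
    exact hΦ.add (hX a) (FieldSmoothNear.sum fun i _ ↦ hX i)

/-- A smooth tensorial operation is computed from its values on a smooth frame. -/
theorem eq_sum_frame (hΦ : SmoothTensorialAt Φ p) {ι : Type*} [Fintype ι]
    {e : ι → Π q : M, TangentSpace I q} {c : ι → Π q : M, TangentSpace I q →ₗ[ℝ] ℝ}
    (he : ∀ i, FieldSmoothNear (e i) p)
    (hc : ∀ i (X : Π q : M, TangentSpace I q), FieldSmoothNear X p →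
      SmoothNear I (fun q ↦ c i q (X q)) p)
    (hec : ∀ᶠ q in 𝓝 p, ∀ x : TangentSpace I q, x = ∑ i, c i q x • e i q)
    {Z : Π p : M, TangentSpace I p} (hZ : FieldSmoothNear Z p) :
    Φ Z = ∑ i, c i p (Z p) • Φ (e i) := by
  have h1 : ∀ i, FieldSmoothNear ((fun q ↦ c i q (Z q)) • e i) p :=
    fun i ↦ FieldSmoothNear.smul (hc i Z hZ) (he i)
  rw [hΦ.congr hZ (FieldSmoothNear.sum fun i (_ : i ∈ Finset.univ) ↦ h1 i)
    (hec.mono fun q hq ↦ hq _), hΦ.sum _ h1]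
  exact Finset.sum_congr rfl fun i _ ↦ hΦ.smul (hc i Z hZ) (he i)

theorem pointwise [FiniteDimensional ℝ E] (hΦ : SmoothTensorialAt Φ p)
    {X Y : Π p : M, TangentSpace I p}
    (hX : FieldSmoothNear X p) (hY : FieldSmoothNear Y p) (h : X p = Y p) : Φ X = Φ Y := by
  obtain ⟨e, c, he, hc, hec⟩ := exists_smooth_frame I p
  have hspan := hec.mono fun q hq ↦ hq.1
  rw [hΦ.eq_sum_frame he hc hspan hX, hΦ.eq_sum_frame he hc hspan hY, h]

end SmoothTensorialAt

end Tensorial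

/-! ### The Jacobi identity and Lie derivatives of one-forms -/

section Jacobi

variable {E : Type*} [NormedAddCommGroup E] [NormedSpace ℝ E] [CompleteSpace E]
  {H : Type*} [TopologicalSpace H] {I : ModelWithCorners ℝ E H}
  {M : Type*} [TopologicalSpace M] [ChartedSpace H M] [IsManifold I ∞ M]
  {f : M → ℝ} {X Y Z : Π p : M, TangentSpace I p} {p : M}

theorem jacobi_mlieBracket (hX : FieldSmoothNear X p) (hY : FieldSmoothNear Y p)
    (hZ : FieldSmoothNear Z p) :
    mlieBracket I X (mlieBracket I Y Z) p =
      mlieBracket I (mlieBracket I X Y) Z p + mlieBracket I Y (mlieBracket I X Z) p := by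
  have : IsManifold I (minSmoothness ℝ 3) M := by
    rw [minSmoothness_of_isRCLikeNormedField]; infer_instance
  have h2 : minSmoothness ℝ 2 ≤ ∞ := by
    rw [minSmoothness_of_isRCLikeNormedField]; exact ENat.LEInfty.out
  exact leibniz_identity_mlieBracket_apply (hX.contMDiffAt.of_le h2) (hY.contMDiffAt.of_le h2)
    (hZ.contMDiffAt.of_le h2)

/-- The Lie bracket acts on functions as the commutator of derivations; this is read off from the
Jacobi identity for `X`, `Y` and `f Z`, whence the vector `Z p` on both sides. -/
theorem mvfderiv_mlieBracket_smul (hf : SmoothNear I f p) (hX : FieldSmoothNear X p)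
    (hY : FieldSmoothNear Y p) (hZ : FieldSmoothNear Z p) :
    mvfderiv I f p (mlieBracket I X Y p) • Z p =
      (mvfderiv I (fun q ↦ mvfderiv I f q (Y q)) p (X p)
        - mvfderiv I (fun q ↦ mvfderiv I f q (X q)) p (Y p)) • Z p := by
  -- the double bracket `[X, [Y, f Z]]` expanded by the Leibniz rule
  have double : ∀ X Y : Π p : M, TangentSpace I p, FieldSmoothNear X p → FieldSmoothNear Y p →
      mlieBracket I X (mlieBracket I Y (f • Z)) p =
        mvfderiv I (fun q ↦ mvfderiv I f q (Y q)) p (X p) • Z p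
          + mvfderiv I f p (Y p) • mlieBracket I X Z p
          + mvfderiv I f p (X p) • mlieBracket I Y Z p
          + f p • mlieBracket I X (mlieBracket I Y Z) p := by
    intro X Y hX hY
    have h1 : ∀ᶠ q in 𝓝 p, mlieBracket I Y (f • Z) q =
        ((fun q ↦ mvfderiv I f q (Y q)) • Z + f • mlieBracket I Y Z) q := by
      filter_upwards [hf.eventually, hZ.eventually] with q hfq hZq
      rw [mlieBracket_smul_right hfq.mdifferentiableAt hZq.mdifferentiableAt]
      rfl
    have hYf := FieldSmoothNear.mvfderiv hf hY
    rw [Filter.EventuallyEq.mlieBracket_vectorField_eq (V := X) (EventuallyEq.refl _ _) h1,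
      mlieBracket_add_right (FieldSmoothNear.smul hYf hZ).mdifferentiableAt
        (FieldSmoothNear.smul hf (hY.mlieBracket hZ)).mdifferentiableAt,
      mlieBracket_smul_right hYf.mdifferentiableAt hZ.mdifferentiableAt,
      mlieBracket_smul_right hf.mdifferentiableAt (hY.mlieBracket hZ).mdifferentiableAt]
    abel
  have e1 := jacobi_mlieBracket hX hY (FieldSmoothNear.smul hf hZ)
  rw [double X Y hX hY, double Y X hY hX,
    mlieBracket_smul_right hf.mdifferentiableAt hZ.mdifferentiableAt,
    jacobi_mlieBracket hX hY hZ] at e1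
  rw [sub_smul, eq_sub_iff_add_eq]
  rw [← sub_eq_zero] at e1 ⊢
  rw [← neg_eq_zero, ← e1]
  module

/-- The Lie bracket acts on functions as the commutator of derivations. -/
theorem mvfderiv_mlieBracket [FiniteDimensional ℝ E] (hf : SmoothNear I f p)
    (hX : FieldSmoothNear X p) (hY : FieldSmoothNear Y p) :
    mvfderiv I f p (mlieBracket I X Y p) =
      mvfderiv I (fun q ↦ mvfderiv I f q (Y q)) p (X p)
        - mvfderiv I (fun q ↦ mvfderiv I f q (X q)) p (Y p) := by
  by_cases h : ∃ z : TangentSpace I p, z ≠ 0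
  · obtain ⟨z, hz⟩ := h
    have := mvfderiv_mlieBracket_smul hf hX hY (FieldSmoothNear.extend z)
    rw [FiberBundle.extend_apply_self] at this
    exact smul_left_injective ℝ hz this
  · -- in dimension `0` both sides vanish
    push Not at h
    simp [h]

/-- The Lie derivative of a one-form `c` along `V`, `W ↦ V (c W) - c [V, W]`, is tensorial. -/
theorem smoothTensorialAt_lieDerivative {V : Π p : M, TangentSpace I p}
    {c : Π q : M, TangentSpace I q →ₗ[ℝ] ℝ}
    (hc : ∀ X : Π q : M, TangentSpace I q, FieldSmoothNear X p →
      SmoothNear I (fun q ↦ c q (X q)) p) :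
    SmoothTensorialAt (fun W : Π p : M, TangentSpace I p ↦
      mvfderiv I (fun q ↦ c q (W q)) p (V p) - c p (mlieBracket I V W p)) p where
  smul {f W} hf hW := by
    have h1 : (fun q ↦ c q ((f • W) q)) = f * fun q ↦ c q (W q) := by funext q; simp
    rw [h1, mvfderiv_mul hf.mdifferentiableAt (hc W hW).mdifferentiableAt,
      mlieBracket_smul_right hf.mdifferentiableAt hW.mdifferentiableAt]
    simp
    ring
  add {W W'} hW hW' := by
    have h1 : (fun q ↦ c q ((W + W') q)) = (fun q ↦ c q (W q)) + fun q ↦ c q (W' q) := by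
      funext q; simp
    rw [h1, mvfderiv_add (hc W hW).mdifferentiableAt (hc W' hW').mdifferentiableAt,
      mlieBracket_add_right hW.mdifferentiableAt hW'.mdifferentiableAt]
    simp
    ring

end Jacobi

/-! ### Smoothness of the Levi-Civita connection and tensoriality of the curvature -/

namespace PseudoRiemannianMetric

variable {E : Type*} [NormedAddCommGroup E] [NormedSpace ℝ E]
  {H : Type*} [TopologicalSpace H] {I : ModelWithCorners ℝ E H}
  {M : Type*} [TopologicalSpace M] [ChartedSpace H M] [IsManifold I ∞ M]
  (g : PseudoRiemannianMetric I M)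

variable {g} {f : M → ℝ} {X X' Y Y' Z W : Π p : M, TangentSpace I p} {p : M}

theorem _root_.FieldSmoothNear.pairing (hX : FieldSmoothNear X p) (hY : FieldSmoothNear Y p) :
    SmoothNear I (g.pairing X Y) p := by
  filter_upwards [hX, hY] with q h1 h2
  have : ContMDiffAt I (I.prod 𝓘(ℝ)) ∞ (fun m ↦ TotalSpace.mk' ℝ
      (E := Bundle.Trivial M ℝ) m (g.val m (X m) (Y m))) q := by
    apply ContMDiffAt.clm_bundle_apply₂ (F₁ := E) (F₂ := E)
    · exact g.contMDiff.contMDiffAt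
    · exact h1
    · exact h2
  simp only [contMDiffAt_totalSpace] at this
  exact this.2

/-- A vector field whose products with all smooth fields are smooth is smooth: its coordinates in a
smooth frame are given by Cramer's rule. -/
theorem fieldSmoothNear_of_pairing [FiniteDimensional ℝ E]
    (h : ∀ Z : Π p : M, TangentSpace I p, FieldSmoothNear Z p →
      SmoothNear I (g.pairing W Z) p) : FieldSmoothNear W p := by
  obtain ⟨e, c, he, hc, hec⟩ := exists_smooth_frame I p
  let G (q : M) : Matrix (Fin (Module.finrank ℝ E)) (Fin (Module.finrank ℝ E)) ℝ :=
    Matrix.of fun i j ↦ g.pairing (e j) (e i) q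
  let w (q : M) (i : Fin (Module.finrank ℝ E)) : ℝ := g.pairing W (e i) q
  have hG : ∀ i j, SmoothNear I (fun q ↦ G q i j) p := fun i j ↦ (he j).pairing (he i)
  have hdet : SmoothNear I (fun q ↦ (G q).det) p := SmoothNear.det hG
  have hdet0 : (G p).det ≠ 0 := by
    intro h0
    obtain ⟨v, hv, hGv⟩ := Matrix.exists_mulVec_eq_zero_iff.2 h0
    obtain ⟨hspan, hdual⟩ := hec.self_of_nhds
    have hz : ∑ j, v j • e j p = 0 := by
      refine g.nondegenerate p _ fun y ↦ ?_
      rw [hspan y]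
      have : ∀ i, g.val p (∑ j, v j • e j p) (e i p) = 0 := by
        intro i
        have := congrFun hGv i
        simp only [Matrix.mulVec, dotProduct, G, Matrix.of_apply, pairing, Pi.zero_apply] at this
        simp [← this, mul_comm]
      rw [map_sum]
      exact Finset.sum_eq_zero fun i _ ↦ by rw [map_smul, this, smul_zero]
    exact hv (funext fun i ↦ by simpa [hdual] using congrArg (c i p) hz)
  have hu : ∀ i, SmoothNear I (fun q ↦ c i q (W q)) p := by
    intro i
    have hnum : SmoothNear I (fun q ↦ ((G q).updateCol i (w q)).det) p := by
      refine SmoothNear.det fun j k ↦ ?_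
      by_cases hk : k = i
      · subst hk
        simpa [Matrix.updateCol_apply] using h _ (he j)
      · simpa [Matrix.updateCol_apply, hk] using hG j k
    refine (hnum.div hdet hdet0).congr ?_
    filter_upwards [hec, hdet.contMDiffAt.continuousAt.eventually_ne hdet0] with q hq hq0
    have hw : w q = (G q).mulVec (fun j ↦ c j q (W q)) := by
      funext j
      simp only [w, G, pairing, Matrix.mulVec, dotProduct, Matrix.of_apply]
      conv_lhs => rw [hq.1 (W q)]
      simp [mul_comm]
    have := congrFun (Matrix.cramer_eq_adjugate_mulVec (G q) (w q)) i
    rw [Matrix.cramer_apply] at this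
    simp only [Pi.div_apply]
    rw [eq_div_iff hq0, this, hw, Matrix.mulVec_mulVec, Matrix.adjugate_mul]
    simp [Matrix.smul_mulVec, mul_comm]
  exact (FieldSmoothNear.sum (s := Finset.univ) fun i _ ↦ FieldSmoothNear.smul (hu i) (he i)).congr
    (hec.mono fun q hq ↦ hq.1 _)

variable [CompleteSpace E]

theorem smoothNear_koszul (hX : FieldSmoothNear X p) (hY : FieldSmoothNear Y p)
    (hZ : FieldSmoothNear Z p) : SmoothNear I (g.koszul X Y Z) p :=
  (((((FieldSmoothNear.mvfderiv (hY.pairing hZ) hX).add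
    (FieldSmoothNear.mvfderiv (hX.pairing hZ) hY)).sub
    (FieldSmoothNear.mvfderiv (hX.pairing hY) hZ)).add ((hX.mlieBracket hY).pairing hZ)).sub
    ((hX.mlieBracket hZ).pairing hY)).sub ((hY.mlieBracket hZ).pairing hX)

variable [FiniteDimensional ℝ E]

/-- The vector field `∇_X Y` for the Levi-Civita connection. -/
def cov (g : PseudoRiemannianMetric I M) (X Y : Π p : M, TangentSpace I p) (p : M) :
    TangentSpace I p := g.leviCivita Y p (X p)

/-- The covariant derivative of a smooth vector field along a smooth vector field is smooth. -/
theorem _root_.FieldSmoothNear.cov (hX : FieldSmoothNear X p) (hY : FieldSmoothNear Y p) :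
    FieldSmoothNear (g.cov X Y) p := by
  refine fieldSmoothNear_of_pairing (g := g) fun Z hZ ↦ ?_
  refine ((SmoothNear.const (1 / 2)).mul (smoothNear_koszul (g := g) hX hY hZ)).congr ?_
  filter_upwards [hX, hY, hZ] with q h1 h2 h3
  have := val_leviCivitaAux (g := g) (h1.mdifferentiableAt (by simp))
    (h2.mdifferentiableAt (by simp)) (h3.mdifferentiableAt (by simp))
  simp only [Pi.mul_apply, ← this]
  simp [pairing, PseudoRiemannianMetric.cov, leviCivita]

theorem cov_add_right (hY : MDiffAt (T% Y) p) (hY' : MDiffAt (T% Y') p) :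
    g.cov X (Y + Y') p = g.cov X Y p + g.cov X Y' p := by
  simp [cov, g.leviCivita.isCovariantDerivativeOn.add hY hY' (Set.mem_univ p)]

theorem cov_smul_right (hf : MDifferentiableAt I 𝓘(ℝ) f p) (hY : MDiffAt (T% Y) p) :
    g.cov X (f • Y) p = f p • g.cov X Y p + mvfderiv I f p (X p) • Y p := by
  simp [cov, g.leviCivita.isCovariantDerivativeOn.leibniz hY hf (Set.mem_univ p)]

theorem cov_sub_right (hY : MDiffAt (T% Y) p) (hY' : MDiffAt (T% Y') p) :
    g.cov X (Y - Y') p = g.cov X Y p - g.cov X Y' p := by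
  have h := cov_add_right (g := g) (X := X) (mdifferentiableAt_sub_section hY hY') hY'
  rw [sub_add_cancel] at h
  exact eq_sub_of_add_eq h.symm

theorem cov_congr (hY : FieldSmoothNear Y p) (h : ∀ᶠ q in 𝓝 p, Y' q = Y q) :
    g.cov X Y' p = g.cov X Y p := by
  have := g.leviCivita.isCovariantDerivativeOn.congr_of_eventuallyEq
    (hY.congr h).mdifferentiableAt hY.mdifferentiableAt univ_mem h
  exact congrArg (fun L ↦ L (X p)) this

theorem mvfderiv_pairing (hX : FieldSmoothNear X p) (hY : FieldSmoothNear Y p)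
    (hZ : FieldSmoothNear Z p) :
    mvfderiv I (g.pairing Y Z) p (X p) =
      g.val p (g.cov X Y p) (Z p) + g.val p (Y p) (g.cov X Z p) :=
  leviCivita_metric hX.mdifferentiableAt hY.mdifferentiableAt hZ.mdifferentiableAt

theorem cov_sub_cov (hX : FieldSmoothNear X p) (hY : FieldSmoothNear Y p) :
    g.cov X Y p - g.cov Y X p = mlieBracket I X Y p :=
  leviCivita_torsion hX.mdifferentiableAt hY.mdifferentiableAt

theorem _root_.FieldSmoothNear.curvature (hX : FieldSmoothNear X p) (hY : FieldSmoothNear Y p)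
    (hZ : FieldSmoothNear Z p) : FieldSmoothNear (g.curvature X Y Z) p :=
  ((hX.cov (hY.cov hZ)).sub (hY.cov (hX.cov hZ))).sub ((hX.mlieBracket hY).cov hZ)

theorem curvature_eq (X Y Z : Π p : M, TangentSpace I p) (p : M) :
    g.curvature X Y Z p =
      g.cov X (g.cov Y Z) p - g.cov Y (g.cov X Z) p - g.cov (mlieBracket I X Y) Z p := rfl

theorem curvature_swap (X Y Z : Π p : M, TangentSpace I p) (p : M) :
    g.curvature Y X Z p = -g.curvature X Y Z p := by
  simp only [curvature, mlieBracket_swap_apply (V := Y) (W := X), map_neg]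
  abel

theorem smoothTensorialAt_curvature_left (Y : Π p : M, TangentSpace I p)
    (hZ : FieldSmoothNear Z p) :
    SmoothTensorialAt (fun X ↦ g.curvature X Y Z p) p where
  smul {f X} hf hX := by
    have h1 : g.cov (f • X) Z = f • g.cov X Z := by funext q; simp [cov]
    have h2 : ∀ W, g.cov (f • X) W p = f p • g.cov X W p := fun W ↦ by simp [cov]
    have h3 : g.cov (mlieBracket I (f • X) Y) Z p =
        -(mvfderiv I f p (Y p)) • g.cov X Z p + f p • g.cov (mlieBracket I X Y) Z p := by
      simp [cov, mlieBracket_smul_left hf.mdifferentiableAt hX.mdifferentiableAt]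
    simp only [curvature_eq]
    rw [h3, h2, h1, cov_smul_right hf.mdifferentiableAt (hX.cov hZ).mdifferentiableAt]
    module
  add {X X'} hX hX' := by
    have h1 : g.cov (X + X') Z = g.cov X Z + g.cov X' Z := by funext q; simp [cov]
    have h2 : ∀ W, g.cov (X + X') W p = g.cov X W p + g.cov X' W p := fun W ↦ by simp [cov]
    have h3 : g.cov (mlieBracket I (X + X') Y) Z p =
        g.cov (mlieBracket I X Y) Z p + g.cov (mlieBracket I X' Y) Z p := by
      simp [cov, mlieBracket_add_left hX.mdifferentiableAt hX'.mdifferentiableAt]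
    simp only [curvature_eq]
    rw [h3, h2, h1, cov_add_right (hX.cov hZ).mdifferentiableAt (hX'.cov hZ).mdifferentiableAt]
    abel

theorem smoothTensorialAt_curvature_right (hX : FieldSmoothNear X p) (hY : FieldSmoothNear Y p) :
    SmoothTensorialAt (fun Z ↦ g.curvature X Y Z p) p where
  smul {f Z} hf hZ := by
    -- the terms of first order in `f` are symmetric in `X` and `Y`, and cancel in the curvature
    have double : ∀ X Y : Π p : M, TangentSpace I p, FieldSmoothNear X p → FieldSmoothNear Y p →
        g.cov X (g.cov Y (f • Z)) p =
          f p • g.cov X (g.cov Y Z) p + mvfderiv I f p (X p) • g.cov Y Z p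
            + mvfderiv I f p (Y p) • g.cov X Z p
            + mvfderiv I (fun q ↦ mvfderiv I f q (Y q)) p (X p) • Z p := by
      intro X Y hX hY
      have hYf := FieldSmoothNear.mvfderiv hf hY
      have hYZ := hY.cov (g := g) hZ
      have h1 : ∀ᶠ q in 𝓝 p, g.cov Y (f • Z) q =
          (f • g.cov Y Z + (fun q ↦ mvfderiv I f q (Y q)) • Z) q := by
        filter_upwards [hf.eventually, hZ.eventually] with q hfq hZq
        exact cov_smul_right hfq.mdifferentiableAt hZq.mdifferentiableAt
      have s1 := FieldSmoothNear.smul hf hYZ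
      have s2 := FieldSmoothNear.smul hYf hZ
      rw [cov_congr (s1.add s2) h1, cov_add_right s1.mdifferentiableAt s2.mdifferentiableAt,
        cov_smul_right hf.mdifferentiableAt hYZ.mdifferentiableAt,
        cov_smul_right hYf.mdifferentiableAt hZ.mdifferentiableAt]
      abel
    simp only [curvature_eq]
    rw [double X Y hX hY, double Y X hY hX,
      cov_smul_right hf.mdifferentiableAt hZ.mdifferentiableAt, mvfderiv_mlieBracket hf hX hY]
    module
  add {Z Z'} hZ hZ' := by
    have double : ∀ X Y : Π p : M, TangentSpace I p, FieldSmoothNear X p → FieldSmoothNear Y p →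
        g.cov X (g.cov Y (Z + Z')) p = g.cov X (g.cov Y Z) p + g.cov X (g.cov Y Z') p := by
      intro X Y hX hY
      have h1 : ∀ᶠ q in 𝓝 p, g.cov Y (Z + Z') q = (g.cov Y Z + g.cov Y Z') q := by
        filter_upwards [hZ.eventually, hZ'.eventually] with q hq hq'
        exact cov_add_right hq.mdifferentiableAt hq'.mdifferentiableAt
      have s1 := hY.cov (g := g) hZ
      have s2 := hY.cov (g := g) hZ'
      rw [cov_congr (s1.add s2) h1, cov_add_right s1.mdifferentiableAt s2.mdifferentiableAt]
    simp only [curvature_eq]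
    rw [double X Y hX hY, double Y X hY hX,
      cov_add_right hZ.mdifferentiableAt hZ'.mdifferentiableAt]
    abel

/-- The curvature of vector fields smooth near `p` is determined by their values at `p`. -/
theorem curvature_congr (hX : FieldSmoothNear X p) (hX' : FieldSmoothNear X' p)
    (hY : FieldSmoothNear Y p) (hY' : FieldSmoothNear Y' p) {Z' : Π p : M, TangentSpace I p}
    (hZ : FieldSmoothNear Z p) (hZ' : FieldSmoothNear Z' p)
    (hXX' : X p = X' p) (hYY' : Y p = Y' p) (hZZ' : Z p = Z' p) :
    g.curvature X Y Z p = g.curvature X' Y' Z' p := by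
  rw [(smoothTensorialAt_curvature_left Y hZ).pointwise hX hX' hXX', ← neg_inj,
    ← curvature_swap, ← curvature_swap,
    (smoothTensorialAt_curvature_left X' hZ).pointwise hY hY' hYY',
    (smoothTensorialAt_curvature_right hY' hX').pointwise hZ hZ' hZZ']

theorem curvatureTensor_eq (hX : FieldSmoothNear X p) (hY : FieldSmoothNear Y p)
    (hZ : FieldSmoothNear Z p) :
    g.curvatureTensor p (X p) (Y p) (Z p) = g.curvature X Y Z p :=
  curvature_congr (.extend _) hX (.extend _) hY (.extend _) hZ (by simp) (by simp) (by simp)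

/-- The endomorphism `x ↦ R(x, y)z` of the tangent space, whose trace is the Ricci tensor. -/
def curvatureEnd (g : PseudoRiemannianMetric I M) (p : M) (y z : TangentSpace I p) :
    TangentSpace I p →ₗ[ℝ] TangentSpace I p where
  toFun x := g.curvatureTensor p x y z
  map_add' x x' := by
    have h := (smoothTensorialAt_curvature_left (g := g) (FiberBundle.extend E y) (.extend z)).add
      (.extend x) (.extend x')
    have h' := curvatureTensor_eq (g := g) ((FieldSmoothNear.extend x).add (.extend x'))
      (.extend y) (.extend z)
    simp only [Pi.add_apply, FiberBundle.extend_apply_self] at h'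
    rw [h', h]
    rfl
  map_smul' a x := by
    have h := (smoothTensorialAt_curvature_left (g := g) (FiberBundle.extend E y) (.extend z)).smul
      (SmoothNear.const a) (.extend x)
    have h' := curvatureTensor_eq (g := g)
      (FieldSmoothNear.smul (SmoothNear.const a) (.extend x)) (.extend y) (.extend z)
    simp only [Pi.smul_apply', FiberBundle.extend_apply_self] at h'
    rw [h', h]
    rfl

theorem ricci_eq_trace (p : M) (y z : TangentSpace I p) :
    g.ricci p y z = LinearMap.trace ℝ (TangentSpace I p) (g.curvatureEnd p y z) := by
  have : FiniteDimensional ℝ (TangentSpace I p) := inferInstanceAs (FiniteDimensional ℝ E)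
  rw [LinearMap.trace_eq_matrix_trace ℝ (Module.finBasis ℝ (TangentSpace I p)), ricci]
  simp [Matrix.trace, LinearMap.toMatrix_apply, curvatureEnd]

end PseudoRiemannianMetric

/-! ### Symmetries of the curvature and Lie derivatives of the Ricci tensor -/

namespace PseudoRiemannianMetric

variable {E : Type*} [NormedAddCommGroup E] [NormedSpace ℝ E] [CompleteSpace E]
  [FiniteDimensional ℝ E]
  {H : Type*} [TopologicalSpace H] {I : ModelWithCorners ℝ E H}
  {M : Type*} [TopologicalSpace M] [ChartedSpace H M] [IsManifold I ∞ M]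
  {g : PseudoRiemannianMetric I M} {f : M → ℝ} {X Y Z W : Π p : M, TangentSpace I p} {p : M}

/-- The first Bianchi identity, a consequence of the Jacobi identity for the Lie bracket. -/
theorem curvature_bianchi (hX : FieldSmoothNear X p) (hY : FieldSmoothNear Y p)
    (hZ : FieldSmoothNear Z p) :
    g.curvature X Y Z p + g.curvature Y Z X p + g.curvature Z X Y p = 0 := by
  have torsion : ∀ X Y Z : Π p : M, TangentSpace I p, FieldSmoothNear X p → FieldSmoothNear Y p →
      FieldSmoothNear Z p → g.cov X (g.cov Y Z) p - g.cov X (g.cov Z Y) p =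
        g.cov (mlieBracket I Y Z) X p + mlieBracket I X (mlieBracket I Y Z) p := by
    intro X Y Z hX hY hZ
    have hYZ := hY.cov (g := g) hZ
    have hZY := hZ.cov (g := g) hY
    have h1 : ∀ᶠ q in 𝓝 p, mlieBracket I Y Z q = (g.cov Y Z - g.cov Z Y) q := by
      filter_upwards [hY.eventually, hZ.eventually] with q h1 h2 using (cov_sub_cov h1 h2).symm
    rw [← cov_sub_cov (g := g) hX (hY.mlieBracket hZ), cov_congr (hYZ.sub hZY) h1,
      cov_sub_right hYZ.mdifferentiableAt hZY.mdifferentiableAt]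
    abel
  have t1 := torsion X Y Z hX hY hZ
  have t2 := torsion Y Z X hY hZ hX
  have t3 := torsion Z X Y hZ hX hY
  have j := jacobi_mlieBracket hX hY hZ
  rw [mlieBracket_swap_apply (V := mlieBracket I X Y),
    mlieBracket_swap (V := X) (W := Z), ← neg_one_smul ℝ (mlieBracket I Z X),
    mlieBracket_const_smul_right (hZ.mlieBracket hX).mdifferentiableAt] at j
  simp only [curvature_eq]
  rw [sub_eq_iff_eq_add] at t1 t2 t3
  rw [t1, t2, t3, j]
  module

theorem mvfderiv_mvfderiv_pairing (hX : FieldSmoothNear X p) (hY : FieldSmoothNear Y p)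
    (hZ : FieldSmoothNear Z p) (hW : FieldSmoothNear W p) :
    mvfderiv I (fun q ↦ mvfderiv I (g.pairing Z W) q (Y q)) p (X p) =
      g.val p (g.cov X (g.cov Y Z) p) (W p) + g.val p (g.cov Y Z p) (g.cov X W p)
        + (g.val p (g.cov X Z p) (g.cov Y W p) + g.val p (Z p) (g.cov X (g.cov Y W) p)) := by
  have h1 : (fun q ↦ mvfderiv I (g.pairing Z W) q (Y q)) =ᶠ[𝓝 p]
      g.pairing (g.cov Y Z) W + g.pairing Z (g.cov Y W) := by
    filter_upwards [hY.eventually, hZ.eventually, hW.eventually] with q h1 h2 h3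
      using mvfderiv_pairing h1 h2 h3
  have hYZ := hY.cov (g := g) hZ
  have hYW := hY.cov (g := g) hW
  rw [mvfderiv_congr h1, mvfderiv_add (hYZ.pairing hW).mdifferentiableAt
    (hZ.pairing hYW).mdifferentiableAt,
    add_apply, mvfderiv_pairing hX hYZ hW, mvfderiv_pairing hX hZ hYW]

/-- The curvature operator `R(X, Y)` is skew-adjoint. -/
theorem curvature_skew (hX : FieldSmoothNear X p) (hY : FieldSmoothNear Y p)
    (hZ : FieldSmoothNear Z p) (hW : FieldSmoothNear W p) :
    g.val p (g.curvature X Y Z p) (W p) = -g.val p (g.curvature X Y W p) (Z p) := by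
  have h := mvfderiv_mlieBracket (hZ.pairing (g := g) hW) hX hY
  rw [mvfderiv_mvfderiv_pairing hX hY hZ hW, mvfderiv_mvfderiv_pairing hY hX hZ hW,
    mvfderiv_pairing (hX.mlieBracket hY) hZ hW] at h
  rw [g.symm p _ (Z p)]
  simp only [curvature_eq, map_sub, sub_apply]
  linarith

theorem curvature_pair_symm (hX : FieldSmoothNear X p) (hY : FieldSmoothNear Y p)
    (hZ : FieldSmoothNear Z p) (hW : FieldSmoothNear W p) :
    g.val p (g.curvature X Y Z p) (W p) = g.val p (g.curvature Z W X p) (Y p) := by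
  have bianchi : ∀ {X Y Z W : Π p : M, TangentSpace I p}, FieldSmoothNear X p →
      FieldSmoothNear Y p → FieldSmoothNear Z p → g.val p (g.curvature X Y Z p) (W p)
        + g.val p (g.curvature Y Z X p) (W p) + g.val p (g.curvature Z X Y p) (W p) = 0 := by
    intro X Y Z W hX hY hZ
    have := congrArg (fun v ↦ g.val p v (W p)) (curvature_bianchi (g := g) hX hY hZ)
    simpa using this
  have swap : ∀ X Y Z W : Π p : M, TangentSpace I p,
      g.val p (g.curvature Y X Z p) (W p) = -g.val p (g.curvature X Y Z p) (W p) := by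
    intro X Y Z W
    simp [curvature_swap X Y Z p]
  -- the Bianchi identities for the four triples, summed up to skew symmetries
  have b1 := bianchi (W := W) hX hY hZ
  have b2 := bianchi (W := X) hY hZ hW
  have b3 := bianchi (W := Y) hZ hW hX
  have b4 := bianchi (W := Z) hW hX hY
  have s1 := curvature_skew (g := g) hX hY hZ hW
  have s2 := curvature_skew (g := g) hY hZ hX hW
  have s3 := curvature_skew (g := g) hZ hX hY hW
  have s4 := curvature_skew (g := g) hZ hW hX hY
  have s5 := curvature_skew (g := g) hW hY hX hZ
  have s6 := curvature_skew (g := g) hW hX hY hZ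
  have w1 := swap Y W Z X
  have w2 := swap X Z W Y
  have w3 := swap Z X Y W
  have w4 := swap Y W X Z
  have w5 := swap X Y W Z
  have w6 := swap X W Y Z
  linarith

/-- Taking the trace commutes with Lie derivatives: the derivative of `ρ(Y, Z)` along `V` is the
trace of the Lie derivative `D` of the field of endomorphisms `x ↦ R(x, Y)Z`. -/
theorem mvfderiv_ricci {V : Π p : M, TangentSpace I p} (hV : FieldSmoothNear V p)
    (hY : FieldSmoothNear Y p) (hZ : FieldSmoothNear Z p)
    (D : TangentSpace I p →ₗ[ℝ] TangentSpace I p)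
    (hD : ∀ X : Π p : M, TangentSpace I p, FieldSmoothNear X p →
      D (X p) = mlieBracket I V (g.curvature X Y Z) p
        - g.curvature (mlieBracket I V X) Y Z p) :
    mvfderiv I (fun q ↦ g.ricci q (Y q) (Z q)) p (V p) =
      LinearMap.trace ℝ (TangentSpace I p) D := by
  have hfin : ∀ q : M, Module.Finite ℝ (TangentSpace I q) :=
    fun q ↦ inferInstanceAs (Module.Finite ℝ E)
  obtain ⟨e, c, he, hc, hec⟩ := exists_smooth_frame I p
  have hW : ∀ i, FieldSmoothNear (g.curvature (e i) Y Z) p := fun i ↦ (he i).curvature hY hZ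
  have hspan := hec.mono fun q hq ↦ hq.1
  -- in the frame, `ρ(Y, Z) = ∑ i, c i (R(e i, Y) Z)`
  have hric : (fun q ↦ g.ricci q (Y q) (Z q)) =ᶠ[𝓝 p]
      fun q ↦ ∑ i, c i q (g.curvature (e i) Y Z q) := by
    filter_upwards [hspan, hY.eventually, hZ.eventually,
      eventually_all.2 fun i ↦ (he i).eventually] with q hq hYq hZq heq
    rw [ricci_eq_trace, LinearMap.trace_eq_sum_coframe hq]
    exact Finset.sum_congr rfl fun i _ ↦
      congrArg (c i q) (curvatureTensor_eq (heq i) hYq hZq)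
  have hconst : ∀ i j, mvfderiv I (fun q ↦ c i q (e j q)) p = 0 := by
    intro i j
    rw [mvfderiv_congr (h := fun _ ↦ if i = j then 1 else 0) (hec.mono fun q hq ↦ hq.2 i j),
      mvfderiv_const]
  have hΦ : ∀ i, mvfderiv I (fun q ↦ c i q (g.curvature (e i) Y Z q)) p (V p) =
      c i p (mlieBracket I V (g.curvature (e i) Y Z) p)
        - ∑ j, c j p (g.curvature (e i) Y Z p) * c i p (mlieBracket I V (e j) p) := by
    intro i
    have := (smoothTensorialAt_lieDerivative (V := V) (hc i)).eq_sum_frame he hc hspan (hW i)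
    simp only [hconst, smul_eq_mul, zero_apply, zero_sub, mul_neg,
      Finset.sum_neg_distrib] at this
    linarith
  have hcurv : ∀ i, c i p (g.curvature (mlieBracket I V (e i)) Y Z p) =
      ∑ j, c j p (mlieBracket I V (e i) p) * c i p (g.curvature (e j) Y Z p) := by
    intro i
    have := (smoothTensorialAt_curvature_left (g := g) Y hZ).eq_sum_frame he hc hspan
      (hV.mlieBracket (he i))
    rw [this, map_sum]
    simp
  rw [mvfderiv_congr hric, mvfderiv_finset_sum _ fun i ↦ hc i _ (hW i),
    LinearMap.trace_eq_sum_coframe hspan.self_of_nhds]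
  simp only [sum_apply, hΦ, hD _ (he _), map_sub, hcurv,
    Finset.sum_sub_distrib]
  congr 1
  rw [Finset.sum_comm]
  exact Finset.sum_congr rfl fun i _ ↦ Finset.sum_congr rfl fun j _ ↦ mul_comm _ _

end PseudoRiemannianMetric

/-! ### The trace of an endomorphism with `L³ = -L` -/

/-- An endomorphism `L` of a real vector space with `L³ = -L` has trace zero: its complex
eigenvalues are among `0, i, -i`, so that its trace is purely imaginary, hence zero. -/
theorem LinearMap.trace_eq_zero_of_cube_eq_neg {V : Type*} [AddCommGroup V] [Module ℝ V]
    [FiniteDimensional ℝ V] (L : V →ₗ[ℝ] V) (hL : ∀ x, L (L (L x)) = -L x) :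
    LinearMap.trace ℝ V L = 0 := by
  let b := Module.finBasis ℝ V
  let A := LinearMap.toMatrix b b L
  have hA : A * A * A = -A := by
    have : L * L * L = -L := LinearMap.ext fun x ↦ by simp [hL]
    simpa [A, LinearMap.toMatrix_mul] using congrArg (LinearMap.toMatrix b b) this
  let B : Matrix _ _ ℂ := (algebraMap ℝ ℂ).mapMatrix A
  have hB : B * B * B = -B := by
    simpa only [map_mul, map_neg] using congrArg (algebraMap ℝ ℂ).mapMatrix hA
  have hroot : ∀ r ∈ B.charpoly.roots, r.re = 0 := by
    intro r hr
    have hr' := (Matrix.mem_spectrum_iff_isRoot_charpoly).2 (Polynomial.isRoot_of_mem_roots hr)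
    rw [← Matrix.spectrum_toLin' , ← Module.End.hasEigenvalue_iff_mem_spectrum] at hr'
    obtain ⟨v, hv⟩ := hr'.exists_hasEigenvector
    have h1 : B.mulVec v = r • v := by simpa using hv.apply_eq_smul
    have h2 : (B * B * B).mulVec v = (r * r * r) • v := by
      rw [← Matrix.mulVec_mulVec, ← Matrix.mulVec_mulVec, h1, Matrix.mulVec_smul, h1,
        Matrix.mulVec_smul, Matrix.mulVec_smul, h1]
      module
    rw [hB, Matrix.neg_mulVec, h1] at h2
    have h3 : r * r * r + r = 0 := by
      refine (smul_eq_zero.1 ?_).resolve_right hv.2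
      rw [add_smul, ← h2]
      simp
    have h4 : r * (r - Complex.I) * (r + Complex.I) = 0 := by
      linear_combination h3 + (-r) * Complex.I_sq
    rcases mul_eq_zero.1 h4 with h5 | h5
    · rcases mul_eq_zero.1 h5 with h6 | h6
      · simp [h6]
      · simp [sub_eq_zero.1 h6]
    · simp [eq_neg_of_add_eq_zero_left h5]
  have htr : (B.trace).re = 0 := by
    rw [Matrix.trace_eq_sum_roots_charpoly, ← Complex.reCLM_apply, map_multiset_sum]
    refine Multiset.sum_eq_zero fun x hx ↦ ?_
    obtain ⟨r, hr, rfl⟩ := Multiset.mem_map.1 hx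
    exact hroot r hr
  rw [LinearMap.trace_eq_matrix_trace ℝ b]
  simpa [B, Matrix.trace, A] using htr

/-! ### Sasaki-like manifolds -/

namespace AlmostContactBMetric

open PseudoRiemannianMetric

variable {n : ℕ} {M : Type*} [TopologicalSpace M]
  [ChartedSpace (EuclideanSpace ℝ (Fin (2 * n + 1))) M]
  [IsManifold (𝓡 (2 * n + 1)) ∞ M] (S : AlmostContactBMetric n M)

/-- The vector field `φ Y`. -/
def phi (Y : Π p : M, TangentSpace (𝓡 (2 * n + 1)) p) (p : M) : TangentSpace (𝓡 (2 * n + 1)) p :=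
  S.φ p (Y p)

variable {S}

theorem val_ξ (p : M) (x : TangentSpace (𝓡 (2 * n + 1)) p) : S.g.val p x (S.ξ p) = S.η p x := by
  have h := S.g_φ_φ p x (S.ξ p)
  rw [S.φ_ξ, S.η_ξ, map_zero] at h
  linarith

theorem ξ_val (p : M) (x : TangentSpace (𝓡 (2 * n + 1)) p) : S.g.val p (S.ξ p) x = S.η p x := by
  rw [S.g.symm, val_ξ]

theorem val_φ_left (p : M) (x y : TangentSpace (𝓡 (2 * n + 1)) p) :
    S.g.val p (S.φ p x) y = S.g.val p x (S.φ p y) := by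
  have h := S.g_φ_φ p (S.φ p x) y
  rw [S.φ_φ, S.η_φ] at h
  simp [ξ_val, S.η_φ] at h
  linarith

theorem pairing_ξ (Y : Π p : M, TangentSpace (𝓡 (2 * n + 1)) p) :
    S.g.pairing Y S.ξ = fun q ↦ S.η q (Y q) := by
  funext q; exact val_ξ q _

variable {X Y Z : Π p : M, TangentSpace (𝓡 (2 * n + 1)) p} {p : M}

theorem fieldSmoothNear_ξ : FieldSmoothNear S.ξ p :=
  Eventually.of_forall fun _ ↦ S.contMDiff_ξ.contMDiffAt

theorem fieldSmoothNear_phi (hY : FieldSmoothNear Y p) : FieldSmoothNear (S.phi Y) p := by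
  filter_upwards [hY] with q h
  exact ContMDiffAt.clm_bundle_apply S.contMDiff_φ.contMDiffAt h

theorem smoothNear_η (hY : FieldSmoothNear Y p) :
    SmoothNear (𝓡 (2 * n + 1)) (fun q ↦ S.η q (Y q)) p :=
  pairing_ξ (S := S) Y ▸ hY.pairing fieldSmoothNear_ξ

section SasakiLike

variable (hS : S.IsSasakiLike)
include hS

theorem IsSasakiLike.cov_phi (hY : FieldSmoothNear Y p) :
    S.g.cov X (S.phi Y) p = S.φ p (S.g.cov X Y p) + (-S.g.val p (X p) (Y p) • S.ξ p
      - S.η p (Y p) • X p + (2 * S.η p (X p) * S.η p (Y p)) • S.ξ p) :=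
  sub_eq_iff_eq_add'.1 (hS p (X p) Y hY.mdifferentiableAt)

/-- `∇ₓ ξ = -φ x`: apply the Sasaki-like condition to the field `φ ξ = 0`. -/
theorem IsSasakiLike.cov_ξ (X : Π p : M, TangentSpace (𝓡 (2 * n + 1)) p) (p : M) :
    S.g.cov X S.ξ p = -S.φ p (X p) := by
  have hX := FieldSmoothNear.extend (I := 𝓡 (2 * n + 1)) (X p)
  have h1 : S.φ p (S.g.cov X S.ξ p) = S.φ p (-S.φ p (X p)) := by
    have h := hS.cov_phi (X := X) (fieldSmoothNear_ξ (S := S) (p := p))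
    have h0 : S.phi S.ξ = 0 := by funext q; exact S.φ_ξ q
    have h0' : S.g.cov X 0 p = 0 := by
      simp [cov, S.g.leviCivita.zero]
    rw [h0, h0', S.η_ξ, val_ξ] at h
    rw [map_neg, S.φ_φ, ← sub_eq_zero]
    rw [← sub_eq_zero] at h
    rw [← neg_eq_zero, ← h]
    module
  -- `ξ` has constant length, so `∇ₓ ξ` is orthogonal to `ξ`
  have h2 : S.η p (S.g.cov X S.ξ p) = 0 := by
    have h := mvfderiv_pairing (g := S.g) hX (fieldSmoothNear_ξ (S := S))
      (fieldSmoothNear_ξ (S := S))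
    have hc : S.g.pairing S.ξ S.ξ = fun _ ↦ 1 := by rw [pairing_ξ]; funext q; exact S.η_ξ q
    rw [hc, mvfderiv_const, val_ξ, ξ_val] at h
    simp [cov] at h ⊢
    linarith
  have h3 := congrArg (S.φ p) h1
  rw [S.φ_φ, S.φ_φ, h2, map_neg, S.η_φ] at h3
  simpa [neg_eq_iff_eq_neg] using h3

/-- `(∇_X η)(Y) = -g(X, φ Y)`. -/
theorem IsSasakiLike.mvfderiv_η (hX : FieldSmoothNear X p) (hY : FieldSmoothNear Y p) :
    mvfderiv (𝓡 (2 * n + 1)) (fun q ↦ S.η q (Y q)) p (X p) =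
      S.η p (S.g.cov X Y p) - S.g.val p (X p) (S.φ p (Y p)) := by
  rw [← pairing_ξ, mvfderiv_pairing hX hY fieldSmoothNear_ξ, hS.cov_ξ, val_ξ, map_neg,
    S.g.symm p (Y p), val_φ_left]
  ring

theorem IsSasakiLike.mlieBracket_ξ (hY : FieldSmoothNear Y p) :
    mlieBracket (𝓡 (2 * n + 1)) S.ξ Y p = S.g.cov S.ξ Y p + S.φ p (Y p) := by
  rw [← cov_sub_cov (g := S.g) fieldSmoothNear_ξ hY, hS.cov_ξ, sub_neg_eq_add]

theorem IsSasakiLike.curvature_right_ξ (hX : FieldSmoothNear X p) (hY : FieldSmoothNear Y p) :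
    S.g.curvature X Y S.ξ p = S.η p (Y p) • X p - S.η p (X p) • Y p := by
  have double : ∀ X Y : Π p : M, TangentSpace (𝓡 (2 * n + 1)) p, FieldSmoothNear Y p →
      S.g.cov X (S.g.cov Y S.ξ) p = -S.g.cov X (S.phi Y) p := by
    intro X Y hY
    have hYφ := fieldSmoothNear_phi (S := S) hY
    have h1 : S.g.cov Y S.ξ = (fun _ : M ↦ (-1 : ℝ)) • S.phi Y := by
      funext q; simpa [phi] using hS.cov_ξ Y q
    rw [h1, cov_smul_right mdifferentiableAt_const hYφ.mdifferentiableAt]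
    simp [mvfderiv_const]
  rw [curvature_eq, double X Y hY, double Y X hX, hS.cov_phi hY, hS.cov_phi hX, hS.cov_ξ,
    ← cov_sub_cov (g := S.g) hX hY, map_sub, S.g.symm p (Y p)]
  module

/-- `R(ξ, X)Y = g(X, Y) ξ - η(Y) X`, by the pair symmetry of the curvature. -/
theorem IsSasakiLike.curvature_ξ (hX : FieldSmoothNear X p) (hY : FieldSmoothNear Y p) :
    S.g.curvature S.ξ X Y p = S.g.val p (X p) (Y p) • S.ξ p - S.η p (Y p) • X p := by
  rw [← sub_eq_zero]
  refine S.g.nondegenerate p _ fun z ↦ ?_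
  have hz := FieldSmoothNear.extend (I := 𝓡 (2 * n + 1)) z
  have h := curvature_pair_symm (g := S.g) (fieldSmoothNear_ξ (S := S)) hX hY hz
  rw [hS.curvature_right_ξ hY hz] at h
  simp only [FiberBundle.extend_apply_self] at h
  simp only [map_sub, map_smul, sub_apply, smul_apply, h, ξ_val, S.g.symm p (X p), smul_eq_mul]
  ring

variable (S) in
omit hS in
/-- The function `2 (g(X, Y) - η(X) η(Y))`; its product with `ξ` is the Lie derivative of the
Levi-Civita connection along `ξ`, see `IsSasakiLike.mlieBracket_ξ_cov`. -/
def connVariation (X Y : Π p : M, TangentSpace (𝓡 (2 * n + 1)) p) (q : M) : ℝ :=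
  2 * (S.g.val q (X q) (Y q) - S.η q (X q) * S.η q (Y q))

omit hS in
theorem connVariation_eq (X Y : Π p : M, TangentSpace (𝓡 (2 * n + 1)) p) :
    S.connVariation X Y =
      (fun _ ↦ 2) * (S.g.pairing X Y - (fun q ↦ S.η q (X q)) * fun q ↦ S.η q (Y q)) := rfl

omit hS in
theorem smoothNear_connVariation (hX : FieldSmoothNear X p) (hY : FieldSmoothNear Y p) :
    SmoothNear (𝓡 (2 * n + 1)) (S.connVariation X Y) p :=
  (SmoothNear.const 2).mul ((hX.pairing hY).sub ((smoothNear_η hX).mul (smoothNear_η hY)))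

theorem IsSasakiLike.mvfderiv_connVariation (hX : FieldSmoothNear X p) (hY : FieldSmoothNear Y p)
    (hZ : FieldSmoothNear Z p) :
    mvfderiv (𝓡 (2 * n + 1)) (S.connVariation Y Z) p (X p) =
      S.connVariation (S.g.cov X Y) Z p + S.connVariation Y (S.g.cov X Z) p
        + 2 * (S.g.val p (X p) (S.φ p (Y p)) * S.η p (Z p)
          + S.η p (Y p) * S.g.val p (X p) (S.φ p (Z p))) := by
  have hYZ := hY.pairing (g := S.g) hZ
  have hηY := smoothNear_η (S := S) hY
  have hηZ := smoothNear_η (S := S) hZ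
  rw [connVariation_eq,
    mvfderiv_mul mdifferentiableAt_const (hYZ.sub (hηY.mul hηZ)).mdifferentiableAt,
    mvfderiv_sub hYZ.mdifferentiableAt (hηY.mul hηZ).mdifferentiableAt,
    mvfderiv_mul hηY.mdifferentiableAt hηZ.mdifferentiableAt, mvfderiv_const]
  simp only [add_apply, sub_apply, smul_apply, smul_eq_mul, zero_apply, mul_zero,
    mvfderiv_pairing hX hY hZ, hS.mvfderiv_η hX hY, hS.mvfderiv_η hX hZ, connVariation]
  ring

/-- The Lie derivative along `ξ` of the Levi-Civita connection. -/
theorem IsSasakiLike.mlieBracket_ξ_cov (hX : FieldSmoothNear X p) (hZ : FieldSmoothNear Z p) :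
    mlieBracket (𝓡 (2 * n + 1)) S.ξ (S.g.cov X Z) p =
      S.g.cov X (mlieBracket (𝓡 (2 * n + 1)) S.ξ Z) p
        + S.g.cov (mlieBracket (𝓡 (2 * n + 1)) S.ξ X) Z p + S.connVariation X Z p • S.ξ p := by
  have hξ := fieldSmoothNear_ξ (S := S) (p := p)
  have h1 : ∀ᶠ q in 𝓝 p, mlieBracket (𝓡 (2 * n + 1)) S.ξ Z q = (S.g.cov S.ξ Z + S.phi Z) q := by
    filter_upwards [hZ.eventually] with q hq using hS.mlieBracket_ξ hq
  have hξZ := hξ.cov (g := S.g) hZ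
  have hφZ := fieldSmoothNear_phi (S := S) hZ
  have h2 := hS.curvature_ξ hX hZ
  rw [curvature_eq, sub_eq_iff_eq_add, sub_eq_iff_eq_add] at h2
  rw [hS.mlieBracket_ξ (hX.cov hZ), cov_congr (hξZ.add hφZ) h1,
    cov_add_right hξZ.mdifferentiableAt hφZ.mdifferentiableAt, hS.cov_phi hZ, h2, connVariation]
  module

end SasakiLike

end AlmostContactBMetric

/-! ### Ricci-like solitons on Sasaki-like manifolds -/

namespace AlmostContactBMetric

open PseudoRiemannianMetric

variable {n : ℕ} {M : Type*} [TopologicalSpace M]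
  [ChartedSpace (EuclideanSpace ℝ (Fin (2 * n + 1))) M]
  [IsManifold (𝓡 (2 * n + 1)) ∞ M] {S : AlmostContactBMetric n M}
  {X Y Z : Π p : M, TangentSpace (𝓡 (2 * n + 1)) p} {p : M}

omit [IsManifold (𝓡 (2 * n + 1)) ∞ M] in
theorem finrank_tangentSpace (p : M) :
    Module.finrank ℝ (TangentSpace (𝓡 (2 * n + 1)) p) = 2 * n + 1 :=
  finrank_euclideanSpace_fin (𝕜 := ℝ) (n := 2 * n + 1)

instance finite_tangentSpace (p : M) : Module.Finite ℝ (TangentSpace (𝓡 (2 * n + 1)) p) :=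
  inferInstanceAs (Module.Finite ℝ (EuclideanSpace ℝ (Fin (2 * n + 1))))

theorem trace_φ (S : AlmostContactBMetric n M) (p : M) :
    LinearMap.trace ℝ (TangentSpace (𝓡 (2 * n + 1)) p) (S.φ p).toLinearMap = 0 :=
  LinearMap.trace_eq_zero_of_cube_eq_neg _ fun x ↦ by simp [S.φ_φ, S.φ_ξ]

theorem mlieBracket_sub_right {V : Π p : M, TangentSpace (𝓡 (2 * n + 1)) p}
    (hX : FieldSmoothNear X p) (hY : FieldSmoothNear Y p) :
    mlieBracket (𝓡 (2 * n + 1)) V (X - Y) p =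
      mlieBracket (𝓡 (2 * n + 1)) V X p - mlieBracket (𝓡 (2 * n + 1)) V Y p := by
  have h := mlieBracket_add_right (V := V) (hX.sub hY).mdifferentiableAt hY.mdifferentiableAt
  rw [sub_add_cancel] at h
  exact eq_sub_of_add_eq h.symm

section SasakiLike

variable (hS : S.IsSasakiLike)
include hS

theorem IsSasakiLike.mlieBracket_ξ_cov_cov (hX : FieldSmoothNear X p) (hY : FieldSmoothNear Y p)
    (hZ : FieldSmoothNear Z p) :
    mlieBracket (𝓡 (2 * n + 1)) S.ξ (S.g.cov X (S.g.cov Y Z)) p =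
      S.g.cov X (S.g.cov Y (mlieBracket (𝓡 (2 * n + 1)) S.ξ Z)) p
        + S.g.cov X (S.g.cov (mlieBracket (𝓡 (2 * n + 1)) S.ξ Y) Z) p
        + S.g.cov (mlieBracket (𝓡 (2 * n + 1)) S.ξ X) (S.g.cov Y Z) p
        + S.connVariation X (S.g.cov Y Z) p • S.ξ p
        - S.connVariation Y Z p • S.φ p (X p)
        + mvfderiv (𝓡 (2 * n + 1)) (S.connVariation Y Z) p (X p) • S.ξ p := by
  have hξ := fieldSmoothNear_ξ (S := S) (p := p)
  have h1 : ∀ᶠ q in 𝓝 p, mlieBracket (𝓡 (2 * n + 1)) S.ξ (S.g.cov Y Z) q =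
      (S.g.cov Y (mlieBracket (𝓡 (2 * n + 1)) S.ξ Z)
        + S.g.cov (mlieBracket (𝓡 (2 * n + 1)) S.ξ Y) Z + S.connVariation Y Z • S.ξ) q := by
    filter_upwards [hY.eventually, hZ.eventually] with q h1 h2 using hS.mlieBracket_ξ_cov h1 h2
  have s1 := hY.cov (g := S.g) (hξ.mlieBracket hZ)
  have s2 := (hξ.mlieBracket hY).cov (g := S.g) hZ
  have hv := smoothNear_connVariation (S := S) hY hZ
  have s3 := FieldSmoothNear.smul hv hξ
  rw [hS.mlieBracket_ξ_cov hX (hY.cov hZ), cov_congr ((s1.add s2).add s3) h1,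
    cov_add_right (s1.add s2).mdifferentiableAt s3.mdifferentiableAt,
    cov_add_right s1.mdifferentiableAt s2.mdifferentiableAt,
    cov_smul_right hv.mdifferentiableAt hξ.mdifferentiableAt, hS.cov_ξ]
  module

/-- The Lie derivative along `ξ` of the curvature tensor. -/
theorem IsSasakiLike.mlieBracket_ξ_curvature (hX : FieldSmoothNear X p)
    (hY : FieldSmoothNear Y p) (hZ : FieldSmoothNear Z p) :
    mlieBracket (𝓡 (2 * n + 1)) S.ξ (S.g.curvature X Y Z) p =
      S.g.curvature (mlieBracket (𝓡 (2 * n + 1)) S.ξ X) Y Z p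
        + S.g.curvature X (mlieBracket (𝓡 (2 * n + 1)) S.ξ Y) Z p
        + S.g.curvature X Y (mlieBracket (𝓡 (2 * n + 1)) S.ξ Z) p
        + (S.connVariation X Z p • S.φ p (Y p) - S.connVariation Y Z p • S.φ p (X p)
          + (2 * (S.η p (Y p) * S.g.val p (X p) (S.φ p (Z p))
            - S.η p (X p) * S.g.val p (Y p) (S.φ p (Z p)))) • S.ξ p) := by
  have hξ := fieldSmoothNear_ξ (S := S) (p := p)
  have hcurv : S.g.curvature X Y Z = S.g.cov X (S.g.cov Y Z) - S.g.cov Y (S.g.cov X Z)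
      - S.g.cov (mlieBracket (𝓡 (2 * n + 1)) X Y) Z := rfl
  have h1 := hX.cov (g := S.g) (hY.cov (g := S.g) hZ)
  have h2 := hY.cov (g := S.g) (hX.cov (g := S.g) hZ)
  have h3 := (hX.mlieBracket hY).cov (g := S.g) hZ
  have hjac : S.g.cov (mlieBracket (𝓡 (2 * n + 1)) S.ξ (mlieBracket (𝓡 (2 * n + 1)) X Y)) Z p =
      S.g.cov (mlieBracket (𝓡 (2 * n + 1)) (mlieBracket (𝓡 (2 * n + 1)) S.ξ X) Y) Z p
        + S.g.cov (mlieBracket (𝓡 (2 * n + 1)) X (mlieBracket (𝓡 (2 * n + 1)) S.ξ Y)) Z p := by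
    simp [cov, jacobi_mlieBracket hξ hX hY]
  have hT : S.connVariation (mlieBracket (𝓡 (2 * n + 1)) X Y) Z p =
      S.connVariation (S.g.cov X Y) Z p - S.connVariation (S.g.cov Y X) Z p := by
    simp only [connVariation, ← cov_sub_cov (g := S.g) hX hY, map_sub, sub_apply]
    ring
  have hsymm : S.g.val p (Y p) (S.φ p (X p)) = S.g.val p (X p) (S.φ p (Y p)) := by
    rw [S.g.symm, val_φ_left]
  rw [hcurv, mlieBracket_sub_right (h1.sub h2) h3, mlieBracket_sub_right h1 h2,
    hS.mlieBracket_ξ_cov_cov hX hY hZ, hS.mlieBracket_ξ_cov_cov hY hX hZ,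
    hS.mlieBracket_ξ_cov (hX.mlieBracket hY) hZ, hS.mvfderiv_connVariation hX hY hZ,
    hS.mvfderiv_connVariation hY hX hZ, hjac, hT, hsymm]
  simp only [curvature_eq]
  module

/-- The Ricci tensor is invariant under the flow of `ξ`. -/
theorem IsSasakiLike.mvfderiv_ricci_ξ (hY : FieldSmoothNear Y p) (hZ : FieldSmoothNear Z p) :
    mvfderiv (𝓡 (2 * n + 1)) (fun q ↦ S.g.ricci q (Y q) (Z q)) p (S.ξ p) =
      S.g.ricci p (mlieBracket (𝓡 (2 * n + 1)) S.ξ Y p) (Z p)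
        + S.g.ricci p (Y p) (mlieBracket (𝓡 (2 * n + 1)) S.ξ Z p) := by
  have hξ := fieldSmoothNear_ξ (S := S) (p := p)
  -- the part of `L_ξ R` that does not come from differentiating `Y` and `Z`
  let N : TangentSpace (𝓡 (2 * n + 1)) p →ₗ[ℝ] TangentSpace (𝓡 (2 * n + 1)) p :=
    ((2 : ℝ) • (S.g.val p (Z p) - S.η p (Z p) • S.η p)).toLinearMap.smulRight (S.φ p (Y p))
      - S.connVariation Y Z p • (S.φ p).toLinearMap
      + ((2 : ℝ) • (S.η p (Y p) • S.g.val p (S.φ p (Z p))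
        - S.g.val p (Y p) (S.φ p (Z p)) • S.η p)).toLinearMap.smulRight (S.ξ p)
  have hN : LinearMap.trace ℝ (TangentSpace (𝓡 (2 * n + 1)) p) N = 0 := by
    simp only [N, map_add, map_sub, map_smul, LinearMap.trace_smulRight, trace_φ]
    simp [S.η_φ, S.η_ξ, val_ξ, S.g.symm p (Z p), val_φ_left]
  rw [mvfderiv_ricci hξ hY hZ (S.g.curvatureEnd p (mlieBracket (𝓡 (2 * n + 1)) S.ξ Y p) (Z p)
    + S.g.curvatureEnd p (Y p) (mlieBracket (𝓡 (2 * n + 1)) S.ξ Z p) + N), map_add, map_add, hN,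
    ← ricci_eq_trace, ← ricci_eq_trace, add_zero]
  intro X hX
  have e1 := curvatureTensor_eq (g := S.g) hX (hξ.mlieBracket hY) hZ
  have e2 := curvatureTensor_eq (g := S.g) hX hY (hξ.mlieBracket hZ)
  rw [hS.mlieBracket_ξ_curvature hX hY hZ, ← e1, ← e2]
  simp only [LinearMap.add_apply, curvatureEnd, LinearMap.coe_mk, AddHom.coe_mk, N]
  simp [connVariation, S.g.symm p (Z p) (X p), S.g.symm p (S.φ p (Z p))]
  module

theorem IsSasakiLike.ricci_ξ (p : M) (y : TangentSpace (𝓡 (2 * n + 1)) p) :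
    S.g.ricci p y (S.ξ p) = 2 * n * S.η p y := by
  have h : S.g.curvatureEnd p y (S.ξ p) =
      S.η p y • LinearMap.id - (S.η p).toLinearMap.smulRight y := by
    ext x
    have hx := FieldSmoothNear.extend (I := 𝓡 (2 * n + 1)) x
    have hy := FieldSmoothNear.extend (I := 𝓡 (2 * n + 1)) y
    have e1 := curvatureTensor_eq (g := S.g) hx hy (fieldSmoothNear_ξ (S := S))
    rw [hS.curvature_right_ξ hx hy] at e1
    simp only [FiberBundle.extend_apply_self] at e1
    simpa [curvatureEnd] using! e1
  rw [ricci_eq_trace, h, map_sub, map_smul, LinearMap.trace_smulRight, LinearMap.trace_id,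
    finrank_tangentSpace]
  simp
  ring

/-- `L_ξ g = -2 g(·, φ ·)`. -/
theorem IsSasakiLike.mvfderiv_pairing_ξ (hY : FieldSmoothNear Y p) (hZ : FieldSmoothNear Z p) :
    mvfderiv (𝓡 (2 * n + 1)) (S.g.pairing Y Z) p (S.ξ p) =
      S.g.val p (mlieBracket (𝓡 (2 * n + 1)) S.ξ Y p) (Z p)
        + S.g.val p (Y p) (mlieBracket (𝓡 (2 * n + 1)) S.ξ Z p)
        - 2 * S.g.val p (Y p) (S.φ p (Z p)) := by
  rw [PseudoRiemannianMetric.mvfderiv_pairing fieldSmoothNear_ξ hY hZ, hS.mlieBracket_ξ hY,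
    hS.mlieBracket_ξ hZ]
  simp [val_φ_left]
  ring

/-- `L_ξ φ = 0`. -/
theorem IsSasakiLike.mlieBracket_ξ_phi (hY : FieldSmoothNear Y p) :
    mlieBracket (𝓡 (2 * n + 1)) S.ξ (S.phi Y) p =
      S.φ p (mlieBracket (𝓡 (2 * n + 1)) S.ξ Y p) := by
  rw [hS.mlieBracket_ξ (fieldSmoothNear_phi hY), hS.mlieBracket_ξ hY, hS.cov_phi hY, ξ_val, S.η_ξ,
    map_add, phi]
  module

/-- `L_ξ η = 0`. -/
theorem IsSasakiLike.mvfderiv_η_ξ (hY : FieldSmoothNear Y p) :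
    mvfderiv (𝓡 (2 * n + 1)) (fun q ↦ S.η q (Y q)) p (S.ξ p) =
      S.η p (mlieBracket (𝓡 (2 * n + 1)) S.ξ Y p) := by
  rw [hS.mvfderiv_η fieldSmoothNear_ξ hY, hS.mlieBracket_ξ hY, map_add, S.η_φ, ξ_val, S.η_φ]
  ring

/-- The soliton equation with `½ L_{kξ} g` written out. -/
theorem IsSasakiLike.ricci_of_soliton {k : M → ℝ}
    (hk : MDifferentiable (𝓡 (2 * n + 1)) 𝓘(ℝ) k) {lam μ ν : ℝ}
    (hsol : S.IsRicciLikeSoliton (fun p ↦ k p • S.ξ p) lam μ ν)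
    (p : M) (x y : TangentSpace (𝓡 (2 * n + 1)) p) :
    S.g.ricci p x y = -lam * S.g.val p x y + (k p - μ) * S.g.val p x (S.φ p y)
      - (μ + ν) * (S.η p x * S.η p y)
      - 1 / 2 * (mvfderiv (𝓡 (2 * n + 1)) k p x * S.η p y
        + mvfderiv (𝓡 (2 * n + 1)) k p y * S.η p x) := by
  have hX := FieldSmoothNear.extend (I := 𝓡 (2 * n + 1)) x
  have hY := FieldSmoothNear.extend (I := 𝓡 (2 * n + 1)) y
  have hξ := fieldSmoothNear_ξ (S := S) (p := p)
  have h := hsol p _ _ hX.mdifferentiableAt hY.mdifferentiableAt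
  have hL := hS.mvfderiv_pairing_ξ hX hY
  change 1 / 2 * S.g.lieDerivative (k • S.ξ) _ _ p + _ + _ + _ + _ = 0 at h
  rw [lieDerivative, mlieBracket_smul_left (hk p) hξ.mdifferentiableAt,
    mlieBracket_smul_left (hk p) hξ.mdifferentiableAt] at h
  simp only [Pi.smul_apply', FiberBundle.extend_apply_self, map_smul, map_add, add_apply,
    smul_apply, smul_eq_mul, ξ_val, val_ξ, assocMetric, hL] at h
  linarith

/-- Evaluating the soliton equation on `ξ`, where `ρ(·, ξ) = 2n η`, shows that `dk` is a constant
multiple of `η`. -/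
theorem IsSasakiLike.mvfderiv_of_soliton {k : M → ℝ}
    (hk : MDifferentiable (𝓡 (2 * n + 1)) 𝓘(ℝ) k) {lam μ ν : ℝ}
    (hsol : S.IsRicciLikeSoliton (fun p ↦ k p • S.ξ p) lam μ ν)
    (p : M) (x : TangentSpace (𝓡 (2 * n + 1)) p) :
    mvfderiv (𝓡 (2 * n + 1)) k p x = -(lam + μ + ν + 2 * n) * S.η p x := by
  have h := hS.ricci_of_soliton hk hsol p x (S.ξ p)
  have hξ := hS.ricci_of_soliton hk hsol p (S.ξ p) (S.ξ p)
  simp only [hS.ricci_ξ, val_ξ, S.η_ξ, S.φ_ξ, map_zero] at h hξ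
  have hdk : mvfderiv (𝓡 (2 * n + 1)) k p (S.ξ p) = -(lam + μ + ν + 2 * n) := by linarith
  rw [hdk] at h
  linarith

theorem IsSasakiLike.ricci_eq_of_soliton {k : M → ℝ}
    (hk : MDifferentiable (𝓡 (2 * n + 1)) 𝓘(ℝ) k) {lam μ ν : ℝ}
    (hsol : S.IsRicciLikeSoliton (fun p ↦ k p • S.ξ p) lam μ ν)
    (p : M) (x y : TangentSpace (𝓡 (2 * n + 1)) p) :
    S.g.ricci p x y = -lam * S.g.val p x y + (k p - μ) * S.g.val p x (S.φ p y)
      + (lam + 2 * n) * (S.η p x * S.η p y) := by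
  rw [hS.ricci_of_soliton hk hsol, hS.mvfderiv_of_soliton hk hsol, hS.mvfderiv_of_soliton hk hsol]
  ring

/-- The equation `L_ξ ρ = 0` for the Ricci tensor of a soliton,
`ρ = -lam g + (k - μ) g(·, φ ·) + (lam + 2n) η ⊗ η`. -/
theorem IsSasakiLike.lieDerivative_ricci_of_soliton {k : M → ℝ}
    (hk : MDifferentiable (𝓡 (2 * n + 1)) 𝓘(ℝ) k) {lam μ ν : ℝ}
    (hsol : S.IsRicciLikeSoliton (fun p ↦ k p • S.ξ p) lam μ ν)
    (p : M) (y z : TangentSpace (𝓡 (2 * n + 1)) p) :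
    (2 * lam - (lam + μ + ν + 2 * n)) * S.g.val p y (S.φ p z)
      - 2 * (k p - μ) * S.g.val p y (S.φ p (S.φ p z)) = 0 := by
  obtain ⟨Y, hY, rfl⟩ : ∃ Y : Π q : M, TangentSpace (𝓡 (2 * n + 1)) q,
    FieldSmoothNear Y p ∧ Y p = y := ⟨_, .extend y, FiberBundle.extend_apply_self _ _⟩
  obtain ⟨Z, hZ, rfl⟩ : ∃ Z : Π q : M, TangentSpace (𝓡 (2 * n + 1)) q,
    FieldSmoothNear Z p ∧ Z p = z := ⟨_, .extend z, FiberBundle.extend_apply_self _ _⟩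
  have hφZ := fieldSmoothNear_phi (S := S) hZ
  have h := hS.mvfderiv_ricci_ξ hY hZ
  have hd : MDifferentiableAt (𝓡 (2 * n + 1)) 𝓘(ℝ) (k - fun _ ↦ μ) p :=
    (hk p).sub mdifferentiableAt_const
  have m1 := (hY.pairing (g := S.g) hZ).mdifferentiableAt
  have m2 := (hY.pairing (g := S.g) hφZ).mdifferentiableAt
  have m3 := (smoothNear_η (S := S) hY).mdifferentiableAt
  have m4 := (smoothNear_η (S := S) hZ).mdifferentiableAt
  have hfun : (fun q ↦ S.g.ricci q (Y q) (Z q)) =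
      (fun _ ↦ -lam) * S.g.pairing Y Z + (k - fun _ ↦ μ) * S.g.pairing Y (S.phi Z)
        + (fun _ ↦ lam + 2 * n) * ((fun q ↦ S.η q (Y q)) * fun q ↦ S.η q (Z q)) := by
    funext q
    exact hS.ricci_eq_of_soliton hk hsol q _ _
  rw [hfun, mvfderiv_add ((mdifferentiableAt_const.mul m1).add (hd.mul m2))
    (mdifferentiableAt_const.mul (m3.mul m4)),
    mvfderiv_add (mdifferentiableAt_const.mul m1) (hd.mul m2),
    mvfderiv_mul mdifferentiableAt_const m1, mvfderiv_mul hd m2,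
    mvfderiv_mul mdifferentiableAt_const (m3.mul m4), mvfderiv_mul m3 m4,
    mvfderiv_sub (hk p) mdifferentiableAt_const] at h
  simp only [add_apply, sub_apply, smul_apply, mvfderiv_const, zero_apply, smul_eq_mul,
    hS.mvfderiv_pairing_ξ hY hZ, hS.mvfderiv_pairing_ξ hY hφZ, hS.mvfderiv_η_ξ hY,
    hS.mvfderiv_η_ξ hZ, hS.mlieBracket_ξ_phi hZ, hS.ricci_eq_of_soliton hk hsol,
    hS.mvfderiv_of_soliton hk hsol, S.η_ξ, pairing, phi, Pi.sub_apply, Pi.mul_apply] at h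
  linarith

end SasakiLike

/-- The horizontal distribution is nonzero, as the dimension is at least `3`. -/
theorem exists_φ_ne_zero (hn : 1 ≤ n) (S : AlmostContactBMetric n M) (p : M) :
    ∃ x : TangentSpace (𝓡 (2 * n + 1)) p, S.φ p x ≠ 0 := by
  by_contra! h
  have h1 : Module.finrank ℝ (TangentSpace (𝓡 (2 * n + 1)) p) ≤ 1 := by
    refine finrank_le_one (S.ξ p) fun x ↦ ⟨S.η p x, ?_⟩
    have := S.φ_φ p x
    rw [h x, map_zero] at this
    exact (neg_add_eq_zero.1 this.symm).symm
  rw [finrank_tangentSpace] at h1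
  omega

/-- On the image of `φ`, where `φ² = -1`, the endomorphism `a - b φ` vanishes only if `a = b = 0`;
here it vanishes because `g` is nondegenerate. -/
theorem eq_zero_of_smul_φ_eq (hn : 1 ≤ n) (S : AlmostContactBMetric n M) (p : M) {a b : ℝ}
    (h : ∀ x y : TangentSpace (𝓡 (2 * n + 1)) p,
      a * S.g.val p y (S.φ p x) - b * S.g.val p y (S.φ p (S.φ p x)) = 0) : b = 0 := by
  obtain ⟨x, hx⟩ := exists_φ_ne_zero hn S p
  have h1 : a • S.φ p x - b • S.φ p (S.φ p x) = 0 :=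
    S.g.nondegenerate p _ fun y ↦ by
      rw [S.g.symm]
      simpa using h x y
  have h2 : a • S.φ p (S.φ p x) + b • S.φ p x = 0 := by
    have := congrArg (S.φ p) h1
    rw [map_sub, map_smul, map_smul, S.φ_φ p (S.φ p x), S.η_φ] at this
    simpa using this
  have h3 : (a ^ 2 + b ^ 2) • S.φ p x = 0 := by
    have h4 : a • (a • S.φ p x - b • S.φ p (S.φ p x))
        + b • (a • S.φ p (S.φ p x) + b • S.φ p x) = 0 := by rw [h1, h2]; simp
    rw [← h4]
    module
  have h5 : a ^ 2 + b ^ 2 = 0 := (smul_eq_zero.1 h3).resolve_right hx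
  nlinarith [sq_nonneg a, sq_nonneg b]

end AlmostContactBMetric

theorem mainTheorem1 (n : ℕ) (hn : 1 ≤ n) {M : Type*} [TopologicalSpace M]
    [ChartedSpace (EuclideanSpace ℝ (Fin (2 * n + 1))) M]
    [IsManifold (𝓡 (2 * n + 1)) ∞ M]
    (S : AlmostContactBMetric n M) (hS : S.IsSasakiLike)
    (k : M → ℝ) (hk : MDifferentiable (𝓡 (2 * n + 1)) 𝓘(ℝ) k)
    (lam μ ν : ℝ) (hsol : S.IsRicciLikeSoliton (fun p ↦ k p • S.ξ p) lam μ ν) :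
    (∀ p : M, k p = μ) ∧
      (∀ p : M, lam + ν = -k p - 2 * n) ∧
      S.IsEtaEinstein (-lam) 0 (lam + 2 * n) := by
  have hkμ : ∀ p, k p = μ := by
    intro p
    have h := AlmostContactBMetric.eq_zero_of_smul_φ_eq hn S p fun x y ↦
      hS.lieDerivative_ricci_of_soliton hk hsol p y x
    linarith
  refine ⟨hkμ, fun p ↦ ?_, fun p x y ↦ ?_, rfl⟩
  · -- `k` is constant, so that the constant ratio of `dk` and `η` vanishes
    have h := hS.mvfderiv_of_soliton hk hsol p (S.ξ p)
    rw [funext hkμ, mvfderiv_const, S.η_ξ, zero_apply] at h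
    rw [hkμ]
    linarith
  · rw [hS.ricci_eq_of_soliton hk hsol, hkμ]
    ring

end
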